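/- Let $\Gamma$ be a group with a finite generating set $S$ and let $(\Gamma_n)_{n\ge 0}$ be a decreasing sequence of finite index normal subgroups of $\Gamma$. Put $G_n=\Gamma/\Gamma_n$ and let $d_{G_n}$ be the right-invariant word metric on $G_n$ with respect to the image of $S$. Let $\widehat\Gamma((\Gamma_n))=\varprojlim G_n$ be the completion of $\Gamma$ along $(\Gamma_n)$, on which $\Gamma$ acts by left multiplication, with the metric $d((g_n),(g'_n))=\max\{a_n : g_n\neq g'_n\}$ (and $0$ if $(g_n)=(g'_n)$), where $(a_n)$ is a sequence of positive reals tending to $0$. Assume that this metric has diameter at most $2$ and that $a_{n+1}<a_n/\operatorname{diam}G_n$ for all $n$ (no condition if $\operatorname{diam}G_n=0$). For a metric space $(Y,d)$ of diameter at most $2$ with an action of $\Gamma$, the warped cone $\mathcal O_\Gamma Y$ is $[1,\infty)\times Y$ with the greatest metric $\rho$ such that $\rho((t,y),(t',y'))\le |t-t'|+\min(t,t')\,d(y,y')$ and $\rho((t,y),(t,sy))\le 1$ for all $s\in S$. A coarse disjoint sum $\bigsqcup_n G_n$ is the disjoint union of the $G_n$ with a metric $D$ that restricts to $d_{G_n}$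 on each $G_n$ and for which the distance between $G_n$ and $G_m$, $n\neq m$, tends to infinity as $\max(n,m)\to\infty$. Call $D$ radial if there are $w_n\ge 0$ such that on $G_n\times G_m$, $n\ne m$, the metric $D$ equals $w_n+w_m$ up to uniform multiplicative and additive constants; for example $D=n+m+\operatorname{diam}G_n+\operatorname{diam}G_m$. A map $f$ from a metric space $(X,d_X)$ to a Hilbert space is a coarse embedding if $\rho_-(d_X(x,x'))\le\|f(x)-f(x')\|\le\rho_+(d_X(x,x'))$ for some nondecreasing functions $\rho_\pm:[0,\infty)\to\mathbb R$ tending to infinity, and a quasi-isometric embedding if $\rho_\pm$ can be chosen affine. Then: (1) For every coarse disjoint sum metric, $\bigsqcup_n G_n$ embeds coarsely into a Hilbert space if and only if $\mathcal O_\Gamma\widehat\Gamma((\Gamma_n))$ does. (2) If $\bigsqcup_n G_n$, with some coarse disjoint sum metric, embeds quasi-isometrically into a Hilbert space, then so does $\mathcal O_\Gamma\widehat\Gamma((\Gamma_n))$. Conversely, if $\mathcal O_\Gamma\widehat\Gamma((\Gamma_n))$ embeds quasi-isometrically into a Hilbert space, then so does $\bigsqcup_n G_n$ with every radial coarse disjoint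 sum metric. (3) If $\bigcap_n\Gamma_n$ is trivial and $\bigsqcup_n G_n$ (with some coarse disjoint sum metric) or $\mathcal O_\Gamma\widehat\Gamma((\Gamma_n))$ embeds coarsely or quasi-isometrically into a Hilbert space, then $\Gamma$ has the Haagerup property, i.e. there is a conditionally negative definite function $\psi:\Gamma\to\mathbb R$ with $\psi(1)=0$ whose sublevel sets are all finite. -/

import Mathlib

open Filter Topology

universe u

noncomputable section

namespace WarpedBox

/-- `d` is a pseudometric on `X` (nonnegativity follows from the three axioms). -/
structure IsPseudoMetric {X : Type*} (d : X → X → ℝ) : Prop where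
  refl : ∀ x, d x x = 0
  symm : ∀ x y, d x y = d y x
  triangle : ∀ x y z, d x z ≤ d x y + d y z

/-! ### Word metrics -/

/-- The word length of `g` with respect to `S`: the least length of a word in the letters
`s`, `s⁻¹` with `s ∈ S` that represents `g`. -/
def wordLength {G : Type*} [Group G] (S : Set G) (g : G) : ℕ :=
  sInf {k | ∃ l : List G, l.length = k ∧ (∀ x ∈ l, x ∈ S ∨ x⁻¹ ∈ S) ∧ l.prod = g}

/-- The right-invariant word metric of `Γ ⧸ N` with respect to the image of `S`. -/
def quotientDist {Γ : Type*} [Group Γ] (S : Finset Γ) (N : Subgroup Γ) [N.Normal]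
    (g h : Γ ⧸ N) : ℕ :=
  wordLength ((fun s : Γ => (s : Γ ⧸ N)) '' (S : Set Γ)) (h * g⁻¹)

/-- The diameter of the (finite) group `Γ ⧸ N` in its right-invariant word metric. -/
def quotientDiam {Γ : Type*} [Group Γ] (S : Finset Γ) (N : Subgroup Γ) [N.Normal] : ℕ :=
  ⨆ p : (Γ ⧸ N) × (Γ ⧸ N), quotientDist S N p.1 p.2

/-! ### Embeddings into Hilbert spaces -/

/-- `(X, d)` embeds coarsely into a (real) Hilbert space. -/
def EmbedsCoarsely {X : Type u} (d : X → X → ℝ) : Prop :=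
  ∃ (H : Type u) (_ : NormedAddCommGroup H) (_ : InnerProductSpace ℝ H) (_ : CompleteSpace H)
    (f : X → H) (lo hi : ℝ → ℝ),
    MonotoneOn lo (Set.Ici 0) ∧ MonotoneOn hi (Set.Ici 0) ∧
    Tendsto lo atTop atTop ∧ Tendsto hi atTop atTop ∧
    ∀ x y, lo (d x y) ≤ ‖f x - f y‖ ∧ ‖f x - f y‖ ≤ hi (d x y)

/-- `(X, d)` embeds quasi-isometrically into a (real) Hilbert space: the control functions
can be chosen affine and increasing. -/
def EmbedsQuasiIsometrically {X : Type u} (d : X → X → ℝ) : Prop :=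
  ∃ (H : Type u) (_ : NormedAddCommGroup H) (_ : InnerProductSpace ℝ H) (_ : CompleteSpace H)
    (f : X → H) (L C : ℝ), 0 < L ∧
    ∀ x y, d x y / L - C ≤ ‖f x - f y‖ ∧ ‖f x - f y‖ ≤ L * d x y + C

/-! ### Coarse disjoint sums (box spaces) -/

/-- `D` is a metric on the disjoint union of the groups `Γ ⧸ N n` that makes it a coarse
disjoint sum: on each `Γ ⧸ N n` it is the right-invariant word metric, and the distance
between two different pieces tends to infinity with their indices. -/
structure IsCoarseDisjointSum {Γ : Type*} [Group Γ] (S : Finset Γ) (N : ℕ → Subgroup Γ)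
    [∀ n, (N n).Normal] (D : (Σ n, Γ ⧸ N n) → (Σ n, Γ ⧸ N n) → ℝ) : Prop where
  pseudo : IsPseudoMetric D
  eq_of_zero : ∀ x y, D x y = 0 → x = y
  restrict : ∀ n (g h : Γ ⧸ N n), D ⟨n, g⟩ ⟨n, h⟩ = quotientDist S (N n) g h
  separated : ∀ R : ℝ, ∃ k : ℕ, ∀ n m, n ≠ m → k ≤ max n m →
    ∀ (g : Γ ⧸ N n) (h : Γ ⧸ N m), R ≤ D ⟨n, g⟩ ⟨m, h⟩

/-- The distances between different pieces of the disjoint union are, up to a multiplicative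
and an additive constant, of the form `w n + w m`. The usual box space metrics, such as
`n + m + diam (Γ ⧸ N n) + diam (Γ ⧸ N m)`, have this property. -/
def IsRadial {Γ : Type*} [Group Γ] (N : ℕ → Subgroup Γ)
    (D : (Σ n, Γ ⧸ N n) → (Σ n, Γ ⧸ N n) → ℝ) : Prop :=
  ∃ (w : ℕ → ℝ) (A B : ℝ), (∀ n, 0 ≤ w n) ∧ 0 < A ∧
    ∀ n m, n ≠ m → ∀ (g : Γ ⧸ N n) (h : Γ ⧸ N m),
      (w n + w m) / A - B ≤ D ⟨n, g⟩ ⟨m, h⟩ ∧ D ⟨n, g⟩ ⟨m, h⟩ ≤ A * (w n + w m) + B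

/-! ### Warped metrics and warped cones -/

/-- The pseudometrics `ρ ≤ d` with `ρ x (s • x) ≤ 1` for all `s ∈ S`. -/
structure IsWarping {Γ X : Type*} [Group Γ] [MulAction Γ X] (S : Finset Γ) (d ρ : X → X → ℝ) :
    Prop where
  pseudo : IsPseudoMetric ρ
  le_dist : ∀ x y, ρ x y ≤ d x y
  smul_le : ∀ s ∈ S, ∀ x, ρ x (s • x) ≤ 1

/-- The warped metric: the greatest pseudometric `ρ ≤ d` with `ρ x (s • x) ≤ 1` for all
`s ∈ S`, that is, the pointwise supremum of all of them. (As soon as one of them is a metric,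
so is the supremum, and it is then the greatest metric with these properties.) -/
def warpedDist {Γ X : Type*} [Group Γ] [MulAction Γ X] (S : Finset Γ) (d : X → X → ℝ)
    (x y : X) : ℝ :=
  ⨆ ρ : {ρ : X → X → ℝ // IsWarping S d ρ}, ρ.1 x y

/-- The underlying set `[1, ∞) × Y` of the cone over `Y`. -/
def Cone (Y : Type*) : Type _ := Set.Ici (1 : ℝ) × Y

/-- The metric of the cone: `|t - t'| + min t t' * d y y'`. -/
def coneDist {Y : Type*} (d : Y → Y → ℝ) (p q : Cone Y) : ℝ :=
  |(p.1 : ℝ) - q.1| + min (p.1 : ℝ) q.1 * d p.2 q.2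

/-- The action `γ (t, y) = (t, γ y)` on the cone. -/
instance {Γ Y : Type*} [Group Γ] [MulAction Γ Y] : MulAction Γ (Cone Y) where
  smul γ p := (p.1, γ • p.2)
  one_smul p := Prod.ext rfl (one_smul Γ p.2)
  mul_smul γ γ' p := Prod.ext rfl (mul_smul γ γ' p.2)

/-- The metric of the warped cone over `(Y, d)`. -/
def warpedConeDist {Γ Y : Type*} [Group Γ] [MulAction Γ Y] (S : Finset Γ) (d : Y → Y → ℝ) :
    Cone Y → Cone Y → ℝ :=
  warpedDist S (coneDist d)

/-! ### The completion of a group along a chain of normal subgroups -/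

section Completion

variable {Γ : Type*} [Group Γ] (N : ℕ → Subgroup Γ) [∀ n, (N n).Normal] (hN : Antitone N)

/-- The quotient homomorphism `Γ ⧸ N (n + 1) → Γ ⧸ N n`. -/
def transition (n : ℕ) : Γ ⧸ N (n + 1) →* Γ ⧸ N n :=
  QuotientGroup.map (N (n + 1)) (N n) (MonoidHom.id Γ) (hN n.le_succ)

/-- The inverse limit of the groups `Γ ⧸ N n`, as a subgroup of their product. -/
def completion : Subgroup (∀ n, Γ ⧸ N n) where
  carrier := {g | ∀ n, transition N hN n (g (n + 1)) = g n}
  one_mem' n := map_one _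
  mul_mem' {g h} hg hh n := by
    rw [Pi.mul_apply, Pi.mul_apply, map_mul, hg n, hh n]
  inv_mem' {g} hg n := by
    rw [Pi.inv_apply, Pi.inv_apply, map_inv, hg n]

/-- The canonical homomorphism from `Γ` to its completion. -/
def toCompletion : Γ →* completion N hN where
  toFun γ := ⟨fun n => (γ : Γ ⧸ N n), fun _ => rfl⟩
  map_one' := rfl
  map_mul' _ _ := rfl

/-- `Γ` acts on its completion by left multiplication. -/
instance : MulAction Γ (completion N hN) :=
  MulAction.compHom (completion N hN) (toCompletion N hN)

variable {N hN}

open Classical in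
/-- The metric `max {a n | g n ≠ h n}` on the completion. -/
def completionDist (a : ℕ → ℝ) (g h : completion N hN) : ℝ :=
  ⨆ n, a n * (if g.1 n = h.1 n then 0 else 1)

end Completion

/-! ### The Haagerup property -/

/-- The Haagerup property of a discrete group: there is a proper function of negative type
(a proper conditionally negative definite function). -/
def HaagerupProperty (Γ : Type*) [Group Γ] : Prop :=
  ∃ ψ : Γ → ℝ, ψ 1 = 0 ∧ (∀ γ, ψ γ⁻¹ = ψ γ) ∧
    (∀ (F : Finset Γ) (c : Γ → ℝ), ∑ γ ∈ F, c γ = 0 →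
      ∑ γ ∈ F, ∑ γ' ∈ F, c γ * c γ' * ψ (γ⁻¹ * γ') ≤ 0) ∧
    ∀ R : ℝ, {γ | ψ γ ≤ R}.Finite

end WarpedBox

end

noncomputable section

namespace WarpedBox

/-! ### Control functions -/

/-! Everything passes through one condition on the quotients G_n = `Γ ⧸ N n`: they embed into one
Hilbert space with common control functions (`UniformEmbedding`). The flag `aff` carries the coarse
and the quasi-isometric case through the same argument.

Let d_n be the word metric of G_n and ρ the warped metric at height t. Then min(d_n, t a_n / 2) ≤ ρ,
and ρ ≤ d_n + t a_(n+1) if G_n is nontrivial (`min_quotientDist_le_levelDist`,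
`levelDist_le_quotientDist_add`). Since a_(n+1) diam G_n < a_n, the level at height max(1, 1 /
a_(n+1)) is a copy of G_n up to uniform constants, so an embedding of the cone yields a uniform
embedding of the quotients (`exists_level_section`).

Conversely, at every height ρ is comparable, up to uniform constants, to d_(n-1) + min(t a_n, d_n)
for a suitable n, the first term being absent at the first nontrivial quotient. The second term is
realised by truncating the embedding of G_n at scale t a_n with a Gaussian kernel
(`exists_truncation`); an orthogonal sum then embeds the level (`exists_level_map`). The maps for
the heights 2 ^ j are joined by tent functions in an ℓ² sum, with the height as an extra coordinate
(`lipschitzEmbedding_warpedConeDist`).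

An embedding of a disjoint sum restricts to the pieces. In the other direction the pieces go to
orthogonal summands, each shifted in a new direction; finiteness of the pieces gives the coarse
estimates, radiality the affine ones.

For the Haagerup property, the squared displacement of the n-th embedding under translation by γ,
averaged over G_n, is of negative type in γ. An ultralimit over n is the required proper function
(`UniformEmbedding.haagerupProperty`). -/

/-- A nonnegative monotone function, bounded by an affine function if `aff` holds. -/
structure Controlled (aff : Prop) (φ : ℝ → ℝ) : Prop where
  mono : Monotone φ
  nonneg : ∀ r, 0 ≤ φ r
  affine : aff → ∃ A, 0 ≤ A ∧ ∀ r, 0 ≤ r → φ r ≤ A * r + A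

/-- Coarse embeddability, with a lower control function that is affine if `aff` holds. -/
def ControlledEmbedding (aff : Prop) {X : Type u} (d : X → X → ℝ) : Prop :=
  ∃ (H : Type u) (_ : NormedAddCommGroup H) (_ : InnerProductSpace ℝ H) (_ : CompleteSpace H)
    (f : X → H), (∀ R, ∃ K, ∀ x y, d x y ≤ R → ‖f x - f y‖ ≤ K) ∧
    ∃ φ, Controlled aff φ ∧ ∀ x y, d x y ≤ φ ‖f x - f y‖

theorem IsPseudoMetric.nonneg {X : Type*} {d : X → X → ℝ} (h : IsPseudoMetric d) (x y : X) :
    0 ≤ d x y := by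
  have := h.triangle x y x
  rw [h.refl, h.symm y x] at this
  linarith

/-- Stability under the changes of control function made below; it preserves affine bounds, so both
kinds of embedding are treated at once. -/
theorem Controlled.comp {aff : Prop} {φ : ℝ → ℝ} (h : Controlled aff φ) {A B C E : ℝ}
    (hA : 0 ≤ A) (hB : 0 ≤ B) (hC : 0 ≤ C) (hE : 0 ≤ E) :
    Controlled aff fun r => A * φ (B * r) + C * max r 0 + E where
  mono r s hrs := by
    have := h.mono (mul_le_mul_of_nonneg_left hrs hB)
    have h2 : max r 0 ≤ max s 0 := max_le_max_right 0 hrs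
    dsimp only
    gcongr
  nonneg r := by
    have := h.nonneg (B * r)
    positivity
  affine ha := by
    obtain ⟨M, hM, hφ⟩ := h.affine ha
    refine ⟨A * M * B + C + A * M + E, by positivity, fun r hr => ?_⟩
    have h1 := mul_le_mul_of_nonneg_left (hφ (B * r) (by positivity)) hA
    rw [max_eq_left hr]
    have : 0 ≤ A * M * r := by positivity
    have : 0 ≤ E * r := by positivity
    have : 0 ≤ A * M * B := by positivity
    nlinarith

theorem exists_monotone_bound (R : ℝ → ℝ) :
    ∃ φ : ℝ → ℝ, Monotone φ ∧ (∀ r, 0 ≤ φ r) ∧ ∀ r, R ⌈r⌉₊ ≤ φ r := by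
  refine ⟨fun r => ∑ i ∈ Finset.range (⌈r⌉₊ + 1), |R i|, fun r s hrs => ?_, fun r => ?_,
    fun r => ?_⟩
  · refine Finset.sum_le_sum_of_subset_of_nonneg (fun i hi => ?_) fun _ _ _ => abs_nonneg _
    have := Nat.ceil_mono hrs
    simp only [Finset.mem_range] at hi ⊢
    omega
  · exact Finset.sum_nonneg fun _ _ => abs_nonneg _
  · exact (le_abs_self _).trans (Finset.single_le_sum (f := fun i : ℕ => |R i|)
      (fun _ _ => abs_nonneg _) (Finset.self_mem_range_succ _))

/-- Converts "bounded `q` forces bounded `p`" into a control function by sampling the bounds at the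
integers; under the flag `False` no affine bound is owed. -/
theorem exists_controlled_of_forall {ι : Type*} {p q : ι → ℝ}
    (h : ∀ K, ∃ R, ∀ i, q i ≤ K → p i ≤ R) :
    ∃ φ : ℝ → ℝ, Controlled False φ ∧ ∀ i, p i ≤ φ (q i) := by
  choose R hR using h
  obtain ⟨φ, h1, h2, h3⟩ := exists_monotone_bound R
  exact ⟨φ, ⟨h1, h2, False.elim⟩, fun i => (hR _ i (Nat.le_ceil _)).trans (h3 _)⟩

theorem EmbedsCoarsely.controlledEmbedding {X : Type u} {d : X → X → ℝ} (hd : ∀ x y, 0 ≤ d x y)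
    (h : EmbedsCoarsely d) : ControlledEmbedding False d := by
  obtain ⟨H, i1, i2, i3, f, lo, hi, -, hhi, hlo', -, hf⟩ := h
  refine ⟨H, i1, i2, i3, f, fun R => ⟨hi (max R 0), fun x y hxy => ?_⟩, ?_⟩
  · exact (hf x y).2.trans (hhi (hd x y) (le_max_right R 0) (hxy.trans (le_max_left _ _)))
  · have : ∀ K, ∃ R, ∀ p : X × X, ‖f p.1 - f p.2‖ ≤ K → d p.1 p.2 ≤ R := fun K => by
      obtain ⟨R, hR⟩ := (hlo'.eventually_gt_atTop K).exists_forall_of_atTop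
      refine ⟨R, fun p hp => ?_⟩
      by_contra! hlt
      linarith [hR _ hlt.le, (hf p.1 p.2).1]
    obtain ⟨φ, h1, h2⟩ := exists_controlled_of_forall this
    exact ⟨φ, h1, fun x y => h2 (x, y)⟩

theorem EmbedsQuasiIsometrically.controlledEmbedding {X : Type u} {d : X → X → ℝ}
    (h : EmbedsQuasiIsometrically d) : ControlledEmbedding True d := by
  obtain ⟨H, i1, i2, i3, f, L, C, hL, hf⟩ := h
  refine ⟨H, i1, i2, i3, f, fun R => ⟨L * R + C, fun x y hxy => (hf x y).2.trans ?_⟩,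
    fun r => L * max r 0 + L * |C|, ⟨fun r s hrs => ?_, fun r => by positivity, fun _ =>
      ⟨L + L * |C|, by positivity, fun r hr => ?_⟩⟩, fun x y => ?_⟩
  · gcongr
  · have h2 : max r 0 ≤ max s 0 := max_le_max_right 0 hrs
    gcongr
  · rw [max_eq_left hr]
    have : 0 ≤ L * |C| * r := by positivity
    nlinarith
  · have h1 := (hf x y).1
    have h2 : d x y / L ≤ ‖f x - f y‖ + C := by linarith
    rw [div_le_iff₀ hL] at h2
    have h3 := mul_le_mul_of_nonneg_left (le_abs_self C) hL.le
    have h4 := mul_le_mul_of_nonneg_left (le_max_left ‖f x - f y‖ 0) hL.le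
    linarith

theorem ControlledEmbedding.embedsCoarsely {X : Type u} {d : X → X → ℝ} {aff : Prop}
    (h : ControlledEmbedding aff d) : EmbedsCoarsely d := by
  obtain ⟨H, i1, i2, i3, f, hf, φ, hφ, hlow⟩ := h
  have : ∀ R, ∃ K, ∀ p : X × X, d p.1 p.2 ≤ R → ‖f p.1 - f p.2‖ ≤ K := fun R =>
    (hf R).imp fun K hK p => hK p.1 p.2
  obtain ⟨hi, hhi, hhi'⟩ := exists_controlled_of_forall this
  -- `lo r` counts the `k` with `φ k + k < r`
  have hfin : ∀ r : ℝ, {k : ℕ | φ k + k < r}.Finite := fun r => by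
    refine (Set.finite_Iio ⌈r⌉₊).subset fun k hk => ?_
    have : (k : ℝ) < r := by
      have := hφ.nonneg k
      simp only [Set.mem_ofPred_eq] at hk
      linarith
    exact Nat.lt_ceil.2 this
  have hmono : Monotone fun r : ℝ => {k : ℕ | φ k + k < r}.ncard := fun r s hrs =>
    Set.ncard_le_ncard (fun k hk => lt_of_lt_of_le hk hrs) (hfin s)
  have hlo : ∀ (n : ℕ) (r : ℝ), φ n + n < r → n + 1 ≤ {k : ℕ | φ k + k < r}.ncard :=
    fun n r h => by
      have : Set.Iic n ⊆ {k : ℕ | φ k + k < r} := fun k hk => by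
        have hk : (k : ℝ) ≤ n := by exact_mod_cast hk
        have := hφ.mono hk
        simp only [Set.mem_ofPred_eq]
        linarith
      have h2 := Set.ncard_le_ncard this (hfin r)
      have h3 : (Set.Iic n).ncard = n + 1 := by
        rw [← Finset.coe_Iic, Set.ncard_coe_finset, Nat.card_Iic]
      omega
  -- The summand `max r 0` makes the upper control function unbounded even where `hi` is bounded.
  refine ⟨H, i1, i2, i3, f, fun r => ({k : ℕ | φ k + k < r}.ncard : ℝ) - 1,
    fun r => hi r + max r 0, fun r _ s _ hrs => ?_, fun r _ s _ hrs => ?_, ?_, ?_,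
    fun x y => ⟨?_, ?_⟩⟩
  · have := hmono hrs
    dsimp only at this ⊢
    have : ({k : ℕ | φ k + k < r}.ncard : ℝ) ≤ {k : ℕ | φ k + k < s}.ncard := by
      exact_mod_cast this
    linarith
  · exact add_le_add (hhi.mono hrs) (max_le_max_right 0 hrs)
  · refine tendsto_atTop.2 fun b => ?_
    filter_upwards [eventually_gt_atTop (φ ⌈b⌉₊ + ⌈b⌉₊)] with r hr
    have h1 : ((⌈b⌉₊ + 1 : ℕ) : ℝ) ≤ {k : ℕ | φ k + k < r}.ncard := by
      exact_mod_cast hlo _ _ hr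
    push_cast at h1
    linarith [Nat.le_ceil b]
  · exact tendsto_atTop_mono (fun r => by
      simp only [id]
      linarith [hhi.nonneg r, le_max_left r 0]) tendsto_id
  · by_contra! hlt
    -- A counted `k ≥ ‖f x - f y‖` would give `d x y ≤ φ k ≤ φ k + k < d x y`. So at most `⌈‖f x - f
    -- y‖⌉₊` integers are counted, and the `- 1` in `lo` absorbs the rounding.
    have hsub : {k : ℕ | φ k + k < d x y} ⊆ Set.Iio ⌈‖f x - f y‖⌉₊ := fun k hk => by
      refine Nat.lt_ceil.2 ?_
      by_contra! hk'
      have := (hlow x y).trans (hφ.mono hk')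
      simp only [Set.mem_ofPred_eq] at hk
      have : (0 : ℝ) ≤ k := by positivity
      linarith
    have h1 := Set.ncard_le_ncard hsub (Set.finite_Iio _)
    rw [← Finset.coe_Iio, Set.ncard_coe_finset, Nat.card_Iio] at h1
    have h2 : ({k : ℕ | φ k + k < d x y}.ncard : ℝ) ≤ (⌈‖f x - f y‖⌉₊ : ℝ) := by
      exact_mod_cast h1
    linarith [Nat.ceil_lt_add_one (norm_nonneg (f x - f y))]
  · exact (hhi' (x, y)).trans (le_add_of_nonneg_right (le_max_right _ _))

theorem embedsQuasiIsometrically_of_controlled {X : Type u} {d : X → X → ℝ}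
    (hd : ∀ x y, 0 ≤ d x y) {H : Type u}
    [NormedAddCommGroup H] [InnerProductSpace ℝ H] [CompleteSpace H] {f : X → H} {L C : ℝ}
    (hf : ∀ x y, ‖f x - f y‖ ≤ L * d x y + C) {φ : ℝ → ℝ} (hφ : Controlled True φ)
    (h : ∀ x y, d x y ≤ φ ‖f x - f y‖) : EmbedsQuasiIsometrically d := by
  obtain ⟨A, hA, hA'⟩ := hφ.affine trivial
  refine ⟨H, inferInstance, inferInstance, inferInstance, f, |L| + A + 1, |C| + 1,
    by positivity, fun x y => ⟨?_, ?_⟩⟩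
  · have h1 := (h x y).trans (hA' _ (norm_nonneg _))
    have h2 : d x y / (|L| + A + 1) ≤ ‖f x - f y‖ + 1 := by
      rw [div_le_iff₀ (by positivity)]
      have : 0 ≤ (‖f x - f y‖ + 1) * (|L| + 1) := by positivity
      nlinarith
    linarith [abs_nonneg C]
  · have h1 := mul_le_mul_of_nonneg_right (le_abs_self L) (hd x y)
    have h2 : 0 ≤ (A + 1) * d x y := mul_nonneg (by positivity) (hd x y)
    nlinarith [hf x y, le_abs_self C]

/-! ### Word metrics on quotients -/

section WordLength

variable {G : Type*} [Group G] {T : Set G}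

theorem wordLength_le {l : List G} (hl : ∀ x ∈ l, x ∈ T ∨ x⁻¹ ∈ T) :
    wordLength T l.prod ≤ l.length :=
  Nat.sInf_le ⟨l, rfl, hl, rfl⟩

theorem wordLength_one : wordLength T (1 : G) = 0 :=
  Nat.le_zero.1 (wordLength_le (T := T) (l := []) (by simp))

theorem wordLength_le_one {s : G} (hs : s ∈ T) : wordLength T s ≤ 1 := by
  have := wordLength_le (T := T) (l := [s]) (by simp [hs])
  simpa using this

theorem exists_word (hT : Subgroup.closure T = ⊤) (g : G) :
    ∃ l : List G, (∀ x ∈ l, x ∈ T ∨ x⁻¹ ∈ T) ∧ l.prod = g ∧ l.length = wordLength T g := by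
  have hne : {k | ∃ l : List G, l.length = k ∧ (∀ x ∈ l, x ∈ T ∨ x⁻¹ ∈ T) ∧
      l.prod = g}.Nonempty := by
    have hg : g ∈ (Subgroup.closure T).toSubmonoid := by rw [hT]; trivial
    rw [Subgroup.closure_toSubmonoid] at hg
    obtain ⟨l, hl, hg⟩ := Submonoid.exists_list_of_mem_closure hg
    exact ⟨l.length, l, rfl, hl, hg⟩
  obtain ⟨l, h1, h2, h3⟩ := Nat.sInf_mem hne
  exact ⟨l, h2, h3, h1⟩

theorem wordLength_inv_le (hT : Subgroup.closure T = ⊤) (g : G) :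
    wordLength T g⁻¹ ≤ wordLength T g := by
  obtain ⟨l, h1, h2, h3⟩ := exists_word hT g
  rw [← h3, ← h2, List.prod_inv_reverse]
  refine (wordLength_le fun x hx => ?_).trans (by simp)
  simp only [List.mem_reverse, List.mem_map] at hx
  obtain ⟨y, hy, rfl⟩ := hx
  simpa using (h1 y hy).symm

theorem wordLength_mul_le (hT : Subgroup.closure T = ⊤) (g h : G) :
    wordLength T (g * h) ≤ wordLength T g + wordLength T h := by
  obtain ⟨l, h1, h2, h3⟩ := exists_word hT g
  obtain ⟨l', h1', h2', h3'⟩ := exists_word hT h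
  rw [← h3, ← h3', ← h2, ← h2', ← List.prod_append, ← List.length_append]
  refine wordLength_le fun x hx => ?_
  rcases List.mem_append.1 hx with hx | hx
  exacts [h1 x hx, h1' x hx]

theorem eq_one_of_wordLength (hT : Subgroup.closure T = ⊤) {g : G} (h : wordLength T g = 0) :
    g = 1 := by
  obtain ⟨l, -, h2, h3⟩ := exists_word hT g
  rw [h, List.length_eq_zero_iff] at h3
  rw [← h2, h3, List.prod_nil]

theorem finite_wordLength_le (hT : Subgroup.closure T = ⊤) (hfin : T.Finite) (k : ℕ) :
    {g : G | wordLength T g ≤ k}.Finite := by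
  have hT' : (T ∪ T⁻¹).Finite := hfin.union hfin.inv
  have : Finite ↥(T ∪ T⁻¹) := hT'
  refine ((List.finite_length_le ↥(T ∪ T⁻¹) k).image
    fun l => (l.map Subtype.val).prod).subset fun g hg => ?_
  obtain ⟨l, h1, h2, h3⟩ := exists_word hT g
  lift l to List ↥(T ∪ T⁻¹) using h1
  exact ⟨l, by simpa [← h3] using hg, h2⟩

/-- A pseudometric for which neighbours are at distance at most `K` is at most `K` times the
word length. -/
theorem le_mul_wordLength (hT : Subgroup.closure T = ⊤) {P : G → G → ℝ} (hP : IsPseudoMetric P)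
    {K : ℝ} (hK : ∀ s ∈ T, ∀ g, P g (s * g) ≤ K) (g h : G) :
    P g h ≤ K * wordLength T (h * g⁻¹) := by
  obtain ⟨l, h1, h2, h3⟩ := exists_word hT (h * g⁻¹)
  have key : ∀ l : List G, (∀ x ∈ l, x ∈ T ∨ x⁻¹ ∈ T) → P g (l.prod * g) ≤ K * l.length := by
    intro l
    induction l with
    | nil => intro _; simp [hP.refl]
    | cons x l ih =>
      intro hl
      have h1 := ih fun y hy => hl y (List.mem_cons_of_mem _ hy)
      have h2 : P (l.prod * g) (x * (l.prod * g)) ≤ K := by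
        rcases hl x List.mem_cons_self with hx | hx
        · exact hK x hx _
        · have := hK _ hx (x * (l.prod * g))
          rwa [inv_mul_cancel_left, hP.symm] at this
      have h3 := hP.triangle g (l.prod * g) (x * (l.prod * g))
      rw [List.prod_cons, List.length_cons, mul_assoc]
      push_cast
      linarith
  have := key l h1
  rwa [h2, h3, inv_mul_cancel_right] at this

end WordLength

section Quotient

variable {Γ : Type*} [Group Γ] {S : Finset Γ}

theorem closure_image_mk (hS : Subgroup.closure (S : Set Γ) = ⊤) (N : Subgroup Γ)
    [N.Normal] :
    Subgroup.closure ((fun s : Γ => (s : Γ ⧸ N)) '' (S : Set Γ)) = ⊤ := by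
  have := (QuotientGroup.mk' N).map_closure (S : Set Γ)
  rw [hS] at this
  rw [← MonoidHom.range_eq_map, MonoidHom.range_eq_top.2 (QuotientGroup.mk'_surjective N)] at this
  exact this.symm

theorem wordLength_mk_le (hS : Subgroup.closure (S : Set Γ) = ⊤) (N : Subgroup Γ)
    [N.Normal] (γ : Γ) :
    wordLength ((fun s : Γ => (s : Γ ⧸ N)) '' (S : Set Γ)) (γ : Γ ⧸ N) ≤
      wordLength (S : Set Γ) γ := by
  obtain ⟨l, h1, h2, h3⟩ := exists_word hS γ
  have := wordLength_le (T := (fun s : Γ => (s : Γ ⧸ N)) '' (S : Set Γ))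
    (l := l.map (QuotientGroup.mk' N)) fun x hx => by
      obtain ⟨y, hy, rfl⟩ := List.mem_map.1 hx
      exact (h1 y hy).imp (fun h => ⟨y, h, rfl⟩) fun h => ⟨y⁻¹, h, rfl⟩
  rwa [← map_list_prod, h2, List.length_map, h3] at this

/-- A shortest word is lifted letter by letter, so quotient geodesics can be followed by elements of
`Γ` acting on the cone. -/
theorem exists_lift_wordLength_le (hS : Subgroup.closure (S : Set Γ) = ⊤) (N : Subgroup Γ)
    [N.Normal] (g : Γ ⧸ N) : ∃ γ : Γ, (γ : Γ ⧸ N) = g ∧ wordLength (S : Set Γ) γ ≤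
      wordLength ((fun s : Γ => (s : Γ ⧸ N)) '' (S : Set Γ)) g := by
  obtain ⟨l, h1, h2, h3⟩ := exists_word (closure_image_mk hS N) g
  rw [← h3, ← h2]
  clear h2 h3
  induction l with
  | nil => exact ⟨1, rfl, wordLength_one.le⟩
  | cons x l ih =>
    obtain ⟨γ, e1, e2⟩ := ih fun y hy => h1 y (List.mem_cons_of_mem _ hy)
    obtain ⟨s, hs, hs'⟩ : ∃ s : Γ, (s : Γ ⧸ N) = x ∧ wordLength (S : Set Γ) s ≤ 1 := by
      rcases h1 x List.mem_cons_self with ⟨s, hs, hx⟩ | ⟨s, hs, hx⟩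
      · exact ⟨s, hx, wordLength_le_one hs⟩
      · exact ⟨s⁻¹, by rw [QuotientGroup.mk_inv, ← inv_inv x, ← hx],
          (wordLength_inv_le hS s).trans (wordLength_le_one hs)⟩
    refine ⟨s * γ, by rw [QuotientGroup.mk_mul, hs, e1, List.prod_cons],
      (wordLength_mul_le hS s γ).trans ?_⟩
    rw [List.length_cons]
    omega

theorem quotientDist_isPseudoMetric (hS : Subgroup.closure (S : Set Γ) = ⊤) (N : Subgroup Γ)
    [N.Normal] :
    IsPseudoMetric fun g h : Γ ⧸ N => (quotientDist S N g h : ℝ) where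
  refl g := by simp [quotientDist, wordLength_one]
  symm g h := by
    have key : ∀ g h : Γ ⧸ N, quotientDist S N g h ≤ quotientDist S N h g := fun g h => by
      have := wordLength_inv_le (closure_image_mk hS N) (g * h⁻¹)
      rwa [mul_inv_rev, inv_inv] at this
    exact_mod_cast le_antisymm (key g h) (key h g)
  triangle g h k := by
    have := wordLength_mul_le (closure_image_mk hS N) (k * h⁻¹) (h * g⁻¹)
    rw [← mul_assoc, inv_mul_cancel_right] at this
    have h2 : quotientDist S N g k ≤ quotientDist S N g h + quotientDist S N h k := by
      rw [add_comm]; exact this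
    exact_mod_cast h2

theorem eq_of_quotientDist_eq_zero (hS : Subgroup.closure (S : Set Γ) = ⊤) (N : Subgroup Γ)
    [N.Normal] {g h : Γ ⧸ N} (H : quotientDist S N g h = 0) : g = h :=
  (mul_inv_eq_one.1 (eq_one_of_wordLength (closure_image_mk hS N) H)).symm

theorem quotientDist_smul_le (N : Subgroup Γ) [N.Normal] {s : Γ} (hs : s ∈ S) (g : Γ ⧸ N) :
    quotientDist S N g (s * g) ≤ 1 := by
  rw [quotientDist, mul_inv_cancel_right]
  exact wordLength_le_one ⟨s, hs, rfl⟩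

theorem quotientDist_le_quotientDiam (N : Subgroup Γ) [N.Normal] [N.FiniteIndex] (g h : Γ ⧸ N) :
    quotientDist S N g h ≤ quotientDiam S N :=
  le_ciSup (f := fun p : (Γ ⧸ N) × (Γ ⧸ N) => quotientDist S N p.1 p.2)
    (Set.finite_range _).bddAbove (g, h)

theorem le_mul_quotientDist (hS : Subgroup.closure (S : Set Γ) = ⊤) (N : Subgroup Γ)
    [N.Normal] {P : (Γ ⧸ N) → (Γ ⧸ N) → ℝ} (hP : IsPseudoMetric P) {K : ℝ}
    (hK : ∀ s ∈ S, ∀ g : Γ ⧸ N, P g (s * g) ≤ K) (g h : Γ ⧸ N) :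
    P g h ≤ K * quotientDist S N g h :=
  le_mul_wordLength (closure_image_mk hS N) hP (by rintro _ ⟨s, hs, rfl⟩ g; exact hK s hs g) g h

end Quotient

theorem abs_min_sub_min_le_left (x y c : ℝ) : |min x c - min y c| ≤ |x - y| :=
  (abs_min_sub_min_le_max x c y c).trans (by simp)

theorem abs_min_sub_min_le_right (c x y : ℝ) : |min c x - min c y| ≤ |x - y| :=
  (abs_min_sub_min_le_max c x c y).trans (by simp)

/-! ### Warped metrics -/

section Warped

variable {Γ X : Type*} [Group Γ] [MulAction Γ X] {S : Finset Γ} {d : X → X → ℝ}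

theorem isWarping_zero (hd : ∀ x y, 0 ≤ d x y) : IsWarping S d fun _ _ => 0 :=
  ⟨⟨fun _ => rfl, fun _ _ => rfl, fun _ _ _ => by simp⟩, hd, fun _ _ _ => zero_le_one⟩

theorem IsWarping.le_warpedDist {ρ : X → X → ℝ} (h : IsWarping S d ρ) (x y : X) :
    ρ x y ≤ warpedDist S d x y :=
  le_ciSup (f := fun ρ : {ρ : X → X → ℝ // IsWarping S d ρ} => ρ.1 x y)
    ⟨d x y, by rintro _ ⟨σ, rfl⟩; exact σ.2.le_dist x y⟩ ⟨ρ, h⟩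

theorem isWarping_warpedDist (hd : ∀ x y, 0 ≤ d x y) : IsWarping S d (warpedDist S d) := by
  have : Nonempty {ρ : X → X → ℝ // IsWarping S d ρ} := ⟨⟨_, isWarping_zero hd⟩⟩
  refine ⟨⟨fun x => ?_, fun x y => ?_, fun x y z => ?_⟩, fun x y => ?_, fun s hs x => ?_⟩
  · exact (iSup_congr fun ρ => ρ.2.pseudo.refl x).trans ciSup_const
  · exact iSup_congr fun ρ => ρ.2.pseudo.symm x y
  · exact ciSup_le fun ρ => (ρ.2.pseudo.triangle x y z).trans
      (add_le_add (ρ.2.le_warpedDist x y) (ρ.2.le_warpedDist y z))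
  · exact ciSup_le fun ρ => ρ.2.le_dist x y
  · exact ciSup_le fun ρ => ρ.2.smul_le s hs x

/-- The pseudometric `|v x - v y|` competes in the supremum. Lower bounds on the warped metric come
from such test functions. -/
theorem le_warpedDist_of_lipschitz {v : X → ℝ} (h : ∀ x y, |v x - v y| ≤ d x y)
    (hs : ∀ s ∈ S, ∀ x, |v x - v (s • x)| ≤ 1) (x y : X) : |v x - v y| ≤ warpedDist S d x y :=
  IsWarping.le_warpedDist (ρ := fun x y => |v x - v y|)
    ⟨⟨fun x => by simp, fun x y => abs_sub_comm _ _, fun x y z => abs_sub_le _ _ _⟩, h, hs⟩ x y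

end Warped

/-! ### Warped cones -/

section Cone

variable {Γ Y : Type*} [Group Γ] [MulAction Γ Y] {S : Finset Γ} {d : Y → Y → ℝ}

theorem Cone.smul_def (γ : Γ) (p : Cone Y) : γ • p = (p.1, γ • p.2) := rfl

/-- The point of the cone at the level `max t 1`. -/
def conePoint (t : ℝ) (y : Y) : Cone Y := (⟨max t 1, le_max_right t 1⟩, y)

theorem conePoint_coe (p : Cone Y) : conePoint (p.1 : ℝ) p.2 = p :=
  Prod.ext (Subtype.ext (max_eq_left p.1.2)) rfl

theorem coneDist_nonneg (hd : ∀ x y, 0 ≤ d x y) (p q : Cone Y) : 0 ≤ coneDist d p q :=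
  add_nonneg (abs_nonneg _) (mul_nonneg (le_min (zero_le_one.trans p.1.2)
    (zero_le_one.trans q.1.2)) (hd _ _))

theorem isWarping_warpedConeDist (hd : ∀ x y, 0 ≤ d x y) :
    IsWarping S (coneDist d) (warpedConeDist S d) :=
  isWarping_warpedDist (coneDist_nonneg hd)

theorem abs_sub_le_warpedConeDist (hd : ∀ x y, 0 ≤ d x y) (p q : Cone Y) :
    |(p.1 : ℝ) - q.1| ≤ warpedConeDist S d p q :=
  le_warpedDist_of_lipschitz (v := fun p : Cone Y => (p.1 : ℝ))
    (fun p q => le_add_of_nonneg_right (mul_nonneg (le_min (zero_le_one.trans p.1.2)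
    (zero_le_one.trans q.1.2)) (hd _ _))) (fun s _ p => by simp [Cone.smul_def]) p q

/-- The warped metric on a level of the cone. -/
def levelDist (S : Finset Γ) (d : Y → Y → ℝ) (t : ℝ) (y z : Y) : ℝ :=
  warpedConeDist S d (conePoint t y) (conePoint t z)

theorem levelDist_isPseudoMetric (hd : ∀ x y, 0 ≤ d x y) (t : ℝ) :
    IsPseudoMetric (levelDist S d t) :=
  have h := (isWarping_warpedConeDist (S := S) hd).pseudo
  ⟨fun _ => h.refl _, fun _ _ => h.symm _ _, fun _ _ _ => h.triangle _ _ _⟩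

theorem levelDist_le (hd : ∀ x y, 0 ≤ d x y) {t : ℝ} (ht : 1 ≤ t) (y z : Y) :
    levelDist S d t y z ≤ t * d y z := by
  refine ((isWarping_warpedConeDist (S := S) hd).le_dist _ _).trans ?_
  simp [coneDist, conePoint, ht]

theorem levelDist_smul_le (hd : ∀ x y, 0 ≤ d x y) (t : ℝ) {s : Γ} (hs : s ∈ S) (y : Y) :
    levelDist S d t y (s • y) ≤ 1 :=
  (isWarping_warpedConeDist (S := S) hd).smul_le s hs _

theorem warpedConeDist_vertical_le (hd : ∀ x y, 0 ≤ d x y) (hd0 : ∀ y, d y y = 0) {t t' : ℝ}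
    (ht : 1 ≤ t) (ht' : 1 ≤ t') (y : Y) :
    warpedConeDist S d (conePoint t y) (conePoint t' y) ≤ |t - t'| := by
  refine ((isWarping_warpedConeDist (S := S) hd).le_dist _ _).trans ?_
  simp [coneDist, conePoint, ht, ht', hd0]

/-- Cutting heights off at `t` is equivariant and does not increase the cone metric, so pulling the
warped metric back along it gives a competitor. -/
theorem levelDist_mono (hd : ∀ x y, 0 ≤ d x y) {t t' : ℝ} (ht : 1 ≤ t) (htt' : t ≤ t')
    (y z : Y) : levelDist S d t y z ≤ levelDist S d t' y z := by
  have hW := isWarping_warpedConeDist (S := S) hd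
  let κ : Cone Y → Cone Y := fun p => conePoint (min (p.1 : ℝ) t) p.2
  have hκ : IsWarping S (coneDist d) fun p q => warpedConeDist S d (κ p) (κ q) := by
    refine ⟨⟨fun _ => hW.pseudo.refl _, fun _ _ => hW.pseudo.symm _ _,
      fun _ _ _ => hW.pseudo.triangle _ _ _⟩, fun p q => (hW.le_dist _ _).trans ?_,
      fun s hs p => hW.smul_le s hs _⟩
    have hp : (1 : ℝ) ≤ p.1 := p.1.2
    have hq : (1 : ℝ) ≤ q.1 := q.1.2
    simp only [coneDist, κ, conePoint, max_eq_left (le_min hp ht), max_eq_left (le_min hq ht)]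
    refine add_le_add (abs_min_sub_min_le_left _ _ _) (mul_le_mul_of_nonneg_right
      (min_le_min (min_le_left _ _) (min_le_left _ _)) (hd _ _))
  have : _ ≤ warpedConeDist S d _ _ := hκ.le_warpedDist (conePoint t' y) (conePoint t' z)
  simpa [κ, conePoint, levelDist, ht.trans htt', ht, htt'] using this

/-- Multiplying heights by `c` scales the cone metric by `c`, so `c⁻¹` times the pulled-back warped
metric is a competitor; the condition on generators uses `1 ≤ c`. -/
theorem levelDist_mul_le (hd : ∀ x y, 0 ≤ d x y) {t c : ℝ} (ht : 1 ≤ t) (hc : 1 ≤ c)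
    (y z : Y) : levelDist S d (c * t) y z ≤ c * levelDist S d t y z := by
  have hW := isWarping_warpedConeDist (S := S) hd
  have hc0 : 0 < c := zero_lt_one.trans_le hc
  let κ : Cone Y → Cone Y := fun p => conePoint (c * p.1) p.2
  have hκ : IsWarping S (coneDist d) fun p q => c⁻¹ * warpedConeDist S d (κ p) (κ q) := by
    refine ⟨⟨fun _ => ?_, fun _ _ => ?_, fun _ _ _ => ?_⟩, fun p q => ?_,
      fun s hs p => ?_⟩
    · rw [hW.pseudo.refl, mul_zero]
    · rw [hW.pseudo.symm]
    · rw [← mul_add]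
      exact mul_le_mul_of_nonneg_left (hW.pseudo.triangle _ _ _) (by positivity)
    · rw [inv_mul_le_iff₀ hc0]
      refine (hW.le_dist _ _).trans ?_
      have hp : (1 : ℝ) ≤ p.1 := p.1.2
      have hq : (1 : ℝ) ≤ q.1 := q.1.2
      simp only [coneDist, κ, conePoint, max_eq_left (one_le_mul_of_one_le_of_one_le hc hp),
        max_eq_left (one_le_mul_of_one_le_of_one_le hc hq)]
      rw [← mul_min_of_nonneg _ _ hc0.le, ← mul_sub, abs_mul, abs_of_pos hc0, mul_assoc, mul_add]
    · rw [inv_mul_le_iff₀ hc0, mul_one]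
      exact (hW.smul_le s hs (κ p)).trans hc
  have h1 : _ ≤ warpedConeDist S d _ _ := hκ.le_warpedDist (conePoint t y) (conePoint t z)
  rw [inv_mul_le_iff₀ hc0] at h1
  simpa [κ, conePoint, levelDist, ht, one_le_mul_of_one_le_of_one_le hc ht] using h1

end Cone

/-! ### The metric on the completion -/

section Completion

theorem ne_top_of_le {Γ : Type*} [Group Γ] {N : ℕ → Subgroup Γ} (hN : Antitone N) {m n : ℕ}
    (hmn : m ≤ n) (hm : N m ≠ ⊤) : N n ≠ ⊤ :=
  fun h => hm (top_le_iff.1 (h ▸ hN hmn))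

variable {Γ : Type*} [Group Γ] {N : ℕ → Subgroup Γ} [∀ n, (N n).Normal] {hN : Antitone N}
  {a : ℕ → ℝ}

theorem completionDist_nonneg (ha : ∀ n, 0 < a n) (g h : completion N hN) :
    0 ≤ completionDist a g h :=
  Real.iSup_nonneg fun n => mul_nonneg (ha n).le (by split_ifs <;> norm_num)

theorem completionDist_comm (g h : completion N hN) :
    completionDist a g h = completionDist a h g :=
  iSup_congr fun n => by
    by_cases H : g.1 n = h.1 n
    · rw [if_pos H, if_pos H.symm]
    · rw [if_neg H, if_neg fun h' => H h'.symm]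

theorem completionDist_self (g : completion N hN) : completionDist a g g = 0 := by
  simp [completionDist]

theorem le_completionDist (ha : ∀ n, 0 < a n) (ha0 : Tendsto a atTop (𝓝 0))
    {g h : completion N hN} {n : ℕ} (hn : g.1 n ≠ h.1 n) : a n ≤ completionDist a g h := by
  classical
  obtain ⟨M, hM⟩ := ha0.bddAbove_range
  have := le_ciSup (f := fun n => a n * (if g.1 n = h.1 n then 0 else 1)) ⟨M, by
    rintro _ ⟨m, rfl⟩
    have h1 := hM ⟨m, rfl⟩
    have h2 := (ha m).le
    dsimp only
    split_ifs <;> simp only [mul_zero, mul_one] <;> linarith⟩ n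
  rw [if_neg hn, mul_one] at this
  refine this.trans (le_of_eq (iSup_congr fun n => ?_))
  congr

theorem completionDist_le {g h : completion N hN} {c : ℝ} (hc : 0 ≤ c)
    (H : ∀ n, g.1 n ≠ h.1 n → a n ≤ c) : completionDist a g h ≤ c := by
  refine ciSup_le fun n => ?_
  split_ifs with hn
  · simpa using hc
  · simpa using H n hn

theorem completion_eq_of_le {g h : completion N hN} {m n : ℕ} (hmn : m ≤ n)
    (H : g.1 n = h.1 n) : g.1 m = h.1 m := by
  induction n, hmn using Nat.le_induction with
  | base => exact H
  | succ n _ ih =>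
    refine ih ?_
    rw [← g.2 n, ← h.2 n, H]

theorem smul_completion_apply (γ : Γ) (g : completion N hN) (n : ℕ) :
    (γ • g).1 n = (γ : Γ ⧸ N n) * g.1 n := rfl

/-- A trivial quotient does not contribute to the metric, so the diameter says nothing about its `a
n`. This is why `N n = ⊤` is repeatedly treated apart. -/
theorem le_two_of_ne_top (ha : ∀ n, 0 < a n) (ha0 : Tendsto a atTop (𝓝 0))
    (hdiam : ∀ g h : completion N hN, completionDist a g h ≤ 2) {n : ℕ} (hn : N n ≠ ⊤) :
    a n ≤ 2 := by
  obtain ⟨γ, hγ⟩ : ∃ γ, γ ∉ N n := by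
    by_contra! h
    exact hn (eq_top_iff.2 fun γ _ => h γ)
  refine (le_completionDist (g := toCompletion N hN γ) (h := 1) ha ha0 (n := n) ?_).trans
    (hdiam _ _)
  intro h
  exact hγ ((QuotientGroup.eq_one_iff γ).1 h)

variable {S : Finset Γ}

theorem one_le_quotientDiam (hS : Subgroup.closure (S : Set Γ) = ⊤) (M : Subgroup Γ) [M.Normal]
    [M.FiniteIndex] (hM : M ≠ ⊤) : 1 ≤ quotientDiam S M := by
  obtain ⟨γ, hγ⟩ : ∃ γ, γ ∉ M := by
    by_contra! h
    exact hM (eq_top_iff.2 fun γ _ => h γ)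
  refine le_trans ?_ (quotientDist_le_quotientDiam M (γ : Γ ⧸ M) 1)
  by_contra! h
  exact hγ ((QuotientGroup.eq_one_iff γ).1 (eq_of_quotientDist_eq_zero hS M (by omega)))

theorem succ_lt_of_ne_top [∀ n, (N n).FiniteIndex] (hS : Subgroup.closure (S : Set Γ) = ⊤)
    (ha : ∀ n, 0 < a n) (hconv : ∀ n, a (n + 1) * (quotientDiam S (N n) : ℝ) < a n) {n : ℕ} (hn : N n ≠ ⊤) :
    a (n + 1) < a n := by
  have h1 : (1 : ℝ) ≤ quotientDiam S (N n) := by exact_mod_cast one_le_quotientDiam hS (N n) hn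
  nlinarith [hconv n, ha (n + 1)]

theorem le_of_le_of_ne_top [∀ n, (N n).FiniteIndex] (hN : Antitone N)
    (hS : Subgroup.closure (S : Set Γ) = ⊤)
    (ha : ∀ n, 0 < a n)
    (hconv : ∀ n, a (n + 1) * (quotientDiam S (N n) : ℝ) < a n) {m n : ℕ} (hmn : m ≤ n)
    (hm : N m ≠ ⊤) : a n ≤ a m := by
  induction n, hmn using Nat.le_induction with
  | base => rfl
  | succ n hn ih =>
    exact (succ_lt_of_ne_top hS ha hconv (ne_top_of_le hN hn hm)).le.trans ih

/-- Points with the same image in a nontrivial quotient are close. -/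
theorem completionDist_le_succ [∀ n, (N n).FiniteIndex] (hS : Subgroup.closure (S : Set Γ) = ⊤)
    (ha : ∀ n, 0 < a n) (hconv : ∀ n, a (n + 1) * (quotientDiam S (N n) : ℝ) < a n) {n : ℕ} (hn : N n ≠ ⊤)
    {g h : completion N hN} (H : g.1 n = h.1 n) : completionDist a g h ≤ a (n + 1) := by
  refine completionDist_le (ha _).le fun m hm => ?_
  have : n + 1 ≤ m := by
    by_contra! hlt
    exact hm (completion_eq_of_le (by omega) H)
  exact le_of_le_of_ne_top hN hS ha hconv this (ne_top_of_le hN (Nat.le_succ n) hn)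

/-! ### Estimates of the metric on the levels -/

/-- The test function at a point of height r over x is the minimum of d_n(x, z) and r a_n / 2; it
vanishes over z, and generators change it by at most 1. -/
theorem min_quotientDist_le_levelDist (hS : Subgroup.closure (S : Set Γ) = ⊤)
    (ha : ∀ n, 0 < a n) (ha0 : Tendsto a atTop (𝓝 0))
    (hdiam : ∀ g h : completion N hN, completionDist a g h ≤ 2) (n : ℕ) {t : ℝ} (ht : 1 ≤ t)
    (y z : completion N hN) :
    min (quotientDist S (N n) (y.1 n) (z.1 n) : ℝ) (t * a n / 2) ≤
      levelDist S (completionDist a) t y z := by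
  have hQ := quotientDist_isPseudoMetric hS (N n)
  by_cases hn : N n = ⊤
  · have : y.1 n = z.1 n := by
      have : Subsingleton (Γ ⧸ N n) := by rw [hn]; exact QuotientGroup.subsingleton_quotient_top
      exact Subsingleton.elim _ _
    refine (min_le_left _ _).trans ?_
    rw [this, hQ.refl]
    exact (levelDist_isPseudoMetric (completionDist_nonneg ha) t).nonneg _ _
  have ha2 := le_two_of_ne_top ha ha0 hdiam hn
  have han := ha n
  let δ : completion N hN → ℝ := fun x => quotientDist S (N n) (x.1 n) (z.1 n)
  have hδ : ∀ x, 0 ≤ δ x := fun x => Nat.cast_nonneg _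
  let v : Cone (completion N hN) → ℝ := fun p => min (δ p.2) ((p.1 : ℝ) * a n / 2)
  -- comparison of two points with `p` not above `q`
  have key : ∀ p q : Cone (completion N hN), (p.1 : ℝ) ≤ q.1 →
      |v p - v q| ≤ coneDist (completionDist a) p q := fun p q hpq => by
    have hp : (1 : ℝ) ≤ p.1 := p.1.2
    -- Vertical moves: the slope `a n / 2` is at most 1.
    have h1 : |v (p.1, q.2) - v q| ≤ |(p.1 : ℝ) - q.1| := by
      refine (abs_min_sub_min_le_right _ _ _).trans ?_
      rw [← sub_div, ← sub_mul, mul_div_assoc, abs_mul, abs_of_nonneg (by linarith : 0 ≤ a n / 2)]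
      exact mul_le_of_le_one_right (abs_nonneg _) (by linarith)
    -- Horizontal moves: `v` changes only if the n-th coordinates differ. Then the base points are
    -- at least `a n` apart, more than enough for the range of `v` at this height.
    have h2 : |v p - v (p.1, q.2)| ≤ p.1 * completionDist a p.2 q.2 := by
      have hpos : 0 ≤ (p.1 : ℝ) * a n := by positivity
      by_cases hne : p.2.1 n = q.2.1 n
      · have : v p = v (p.1, q.2) := by simp [v, δ, hne]
        rw [this, sub_self, abs_zero]
        exact mul_nonneg (by linarith) (completionDist_nonneg ha _ _)
      · have h3 := mul_le_mul_of_nonneg_left (le_completionDist ha ha0 hne)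
          (zero_le_one.trans hp)
        refine le_trans ?_ h3
        have b1 : v p ≤ p.1 * a n / 2 := min_le_right _ _
        have b2 : v (p.1, q.2) ≤ p.1 * a n / 2 := min_le_right _ _
        have b3 : 0 ≤ v p := le_min (hδ _) (by linarith)
        have b4 : 0 ≤ v (p.1, q.2) := le_min (hδ _) (by
          show 0 ≤ (p.1 : ℝ) * a n / 2
          linarith)
        rw [abs_le]
        constructor <;> linarith
    have h3 := abs_sub_le (v p) (v (p.1, q.2)) (v q)
    rw [coneDist, min_eq_left hpq]
    linarith
  have hlip : ∀ p q, |v p - v q| ≤ coneDist (completionDist a) p q := fun p q => by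
    rcases le_total (p.1 : ℝ) q.1 with h | h
    · exact key p q h
    · have h1 := key q p h
      rw [coneDist] at h1 ⊢
      rwa [abs_sub_comm, abs_sub_comm (p.1 : ℝ), min_comm, completionDist_comm]
  have hsmul : ∀ s ∈ S, ∀ p, |v p - v (s • p)| ≤ 1 := fun s hs p => by
    refine (abs_min_sub_min_le_left _ _ _).trans ?_
    have h1 : (quotientDist S (N n) (p.2.1 n) (s * p.2.1 n) : ℝ) ≤ 1 := by
      exact_mod_cast quotientDist_smul_le (N n) hs (p.2.1 n)
    have h2 := hQ.triangle (p.2.1 n) (s * p.2.1 n) (z.1 n)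
    have h3 := hQ.triangle (s * p.2.1 n) (p.2.1 n) (z.1 n)
    have h4 := hQ.symm (s * p.2.1 n) (p.2.1 n)
    simp only [δ, Cone.smul_def, smul_completion_apply]
    rw [abs_le]
    constructor <;> linarith
  have := le_warpedDist_of_lipschitz hlip hsmul (conePoint t y) (conePoint t z)
  have e1 : v (conePoint t y) = min (δ y) (t * a n / 2) := by simp [v, conePoint, ht]
  have e2 : v (conePoint t z) = 0 := by
    have : δ z = 0 := hQ.refl _
    have h0 : 0 ≤ t * a n / 2 := by positivity
    simp [v, conePoint, ht, this, h0]
  rw [e1, e2, sub_zero, abs_of_nonneg (le_min (hδ _) (by positivity))] at this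
  exact this

theorem levelDist_smul_le_wordLength (hS : Subgroup.closure (S : Set Γ) = ⊤) {Y : Type*}
    [MulAction Γ Y] {d : Y → Y → ℝ} (hd : ∀ x y, 0 ≤ d x y) (t : ℝ) (γ : Γ) (y : Y) :
    levelDist S d t y (γ • y) ≤ wordLength (S : Set Γ) γ := by
  have hρ := levelDist_isPseudoMetric (S := S) hd t
  have := le_mul_wordLength hS (P := fun g h => levelDist S d t (g • y) (h • y))
    ⟨fun _ => hρ.refl _, fun _ _ => hρ.symm _ _, fun _ _ _ => hρ.triangle _ _ _⟩ (K := 1)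
    (fun s hs g => by rw [mul_smul]; exact levelDist_smul_le hd t hs _) 1 γ
  simpa using this

/-- Move `y` along the orbit by a shortest lift γ of `z n * (y n)⁻¹`. Then `γ • y` and `z` agree up
to index `n`, leaving at most `t * a (n + 1)`. -/
theorem levelDist_le_quotientDist_add [∀ n, (N n).FiniteIndex]
    (hS : Subgroup.closure (S : Set Γ) = ⊤)
    (ha : ∀ n, 0 < a n)
    (hconv : ∀ n, a (n + 1) * (quotientDiam S (N n) : ℝ) < a n) {n : ℕ} (hn : N n ≠ ⊤)
    {t : ℝ} (ht : 1 ≤ t) (y z : completion N hN) :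
    levelDist S (completionDist a) t y z ≤
      quotientDist S (N n) (y.1 n) (z.1 n) + t * a (n + 1) := by
  have hd := completionDist_nonneg (N := N) (hN := hN) ha
  obtain ⟨γ, h1, h2⟩ := exists_lift_wordLength_le hS (N n) (z.1 n * (y.1 n)⁻¹)
  have h2' : (wordLength (S : Set Γ) γ : ℝ) ≤ quotientDist S (N n) (y.1 n) (z.1 n) := by
    exact_mod_cast h2
  have h1' : (γ • y).1 n = z.1 n := by
    rw [smul_completion_apply, h1, inv_mul_cancel_right]
  have h3 := (levelDist_isPseudoMetric (S := S) hd t).triangle y (γ • y) z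
  have h4 := levelDist_le (S := S) hd ht (γ • y) z
  have h5 := mul_le_mul_of_nonneg_left
    (completionDist_le_succ (g := γ • y) (h := z) hS ha hconv hn h1') (zero_le_one.trans ht)
  linarith [levelDist_smul_le_wordLength hS hd t γ y]

end Completion

/-! ### Truncation of Hilbert space valued maps -/

/-- Entrywise powers of a Gram matrix are positive semidefinite by Schur's product theorem, and the
exponential series has nonnegative coefficients. -/
theorem posSemidef_exp_gram {X H : Type*} [Fintype X] [NormedAddCommGroup H]
    [InnerProductSpace ℝ H] (v : X → H) :
    (Matrix.of fun i j => Real.exp (inner ℝ (v i) (v j)) : Matrix X X ℝ).PosSemidef := by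
  have hpow : ∀ k : ℕ,
      (Matrix.of fun i j => (inner ℝ (v i) (v j)) ^ k : Matrix X X ℝ).PosSemidef := by
    intro k
    induction k with
    | zero =>
      have h : (Matrix.of fun i j => (inner ℝ (v i) (v j)) ^ 0 : Matrix X X ℝ) =
          Matrix.gram ℝ fun _ : X => (1 : ℝ) := by
        ext i j
        simp
      rw [h]
      exact Matrix.posSemidef_gram ℝ _
    | succ k ih =>
      have h : (Matrix.of fun i j => (inner ℝ (v i) (v j)) ^ (k + 1) : Matrix X X ℝ) =
          (Matrix.of fun i j => (inner ℝ (v i) (v j)) ^ k).hadamard (Matrix.gram ℝ v) := by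
        ext i j
        simp [pow_succ]
      rw [h]
      exact ih.hadamard (Matrix.posSemidef_gram ℝ v)
  refine Matrix.PosSemidef.of_dotProduct_mulVec_nonneg (Matrix.ext fun i j => ?_) fun x => ?_
  · simp [real_inner_comm]
  · have hsum : HasSum (fun k : ℕ => (k.factorial : ℝ)⁻¹ * (star x ⬝ᵥ
        (Matrix.of fun i j => (inner ℝ (v i) (v j)) ^ k : Matrix X X ℝ).mulVec x))
        (star x ⬝ᵥ (Matrix.of fun i j => Real.exp (inner ℝ (v i) (v j))).mulVec x) := by
      simp only [dotProduct, Matrix.mulVec, Matrix.of_apply, Finset.mul_sum]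
      refine hasSum_sum fun i _ => hasSum_sum fun j _ => ?_
      have h1 := NormedSpace.expSeries_div_hasSum_exp (inner ℝ (v i) (v j))
      rw [← Real.exp_eq_exp_ℝ] at h1
      refine ((h1.mul_right (x j)).mul_left (star x i)).congr_fun fun k => ?_
      ring
    exact hsum.nonneg fun k => mul_nonneg (by positivity) ((hpow k).dotProduct_mulVec_nonneg x)

-- Multiplying the exponential Gram matrix entrywise by a rank one Gram matrix gives the Gaussian
-- kernel. Write it as `Bᴴ B`; the columns of `B` are unit vectors with these inner products.
open scoped MatrixOrder in
theorem exists_gaussian_map {X H : Type*} [Fintype X] [NormedAddCommGroup H]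
    [InnerProductSpace ℝ H] (v : X → H) :
    ∃ g : X → EuclideanSpace ℝ X, ∀ x y, ‖g x - g y‖ ^ 2 =
      2 * (1 - Real.exp (-(‖v x - v y‖ ^ 2 / 2))) := by
  classical
  have hM := (posSemidef_exp_gram v).hadamard
    (Matrix.posSemidef_gram ℝ fun x => Real.exp (-(‖v x‖ ^ 2 / 2)))
  obtain ⟨B, hB⟩ := CStarAlgebra.nonneg_iff_eq_star_mul_self.mp hM.nonneg
  have hin : ∀ x y, ∑ i, B i x * B i y = Real.exp (-(‖v x - v y‖ ^ 2 / 2)) := fun x y => by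
    have := congrFun (congrFun hB x) y
    simp only [Matrix.hadamard, Matrix.of_apply, Matrix.gram_apply, Matrix.star_eq_conjTranspose,
      Matrix.mul_apply, Matrix.conjTranspose_apply, star_trivial] at this
    rw [← this, RCLike.inner_apply, conj_trivial, ← Real.exp_add, ← Real.exp_add]
    congr 1
    rw [norm_sub_sq_real]
    ring
  refine ⟨fun x => WithLp.toLp 2 fun i => B i x, fun x y => ?_⟩
  rw [EuclideanSpace.norm_sq_eq]
  simp only [PiLp.sub_apply, Real.norm_eq_abs, sq_abs]
  have h1 := hin x x
  have h2 := hin y y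
  have h3 := hin x y
  rw [sub_self, norm_zero] at h1 h2
  have : ∑ i, (B i x - B i y) ^ 2 =
      ∑ i, B i x * B i x + ∑ i, B i y * B i y - 2 * ∑ i, B i x * B i y := by
    rw [Finset.mul_sum, ← Finset.sum_add_distrib, ← Finset.sum_sub_distrib]
    exact Finset.sum_congr rfl fun i _ => by ring
  rw [this, h1, h2, h3]
  norm_num
  ring

theorem half_min_one_le_one_sub_exp {r : ℝ} (hr : 0 ≤ r) :
    min 1 r / 2 ≤ 1 - Real.exp (-r) := by
  have key : ∀ s : ℝ, 0 ≤ s → s ≤ 1 → s / 2 ≤ 1 - Real.exp (-s) := fun s h0 h1 => by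
    have h2 := Real.add_one_le_exp s
    have h3 : Real.exp (-s) ≤ (1 + s)⁻¹ := by
      rw [Real.exp_neg]
      exact inv_anti₀ (by linarith) (by linarith)
    have h4 : (1 + s)⁻¹ ≤ 1 - s / 2 := by
      rw [inv_le_iff_one_le_mul₀ (by linarith)]
      nlinarith
    linarith
  rcases le_total 1 r with h | h
  · rw [min_eq_left h]
    have := key 1 zero_le_one le_rfl
    have h2 := Real.exp_le_exp.2 (neg_le_neg h)
    linarith
  · rw [min_eq_right h]
    exact key r hr h

/-- A map from a finite set to a Hilbert space can be truncated at a given scale. -/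
theorem exists_truncation {X H : Type*} [Fintype X] [NormedAddCommGroup H]
    [InnerProductSpace ℝ H] (f : X → H) {τ : ℝ} (hτ : 0 < τ) :
    ∃ g : X → EuclideanSpace ℝ X, ∀ x y, min τ ‖f x - f y‖ ≤ 2 * ‖g x - g y‖ ∧
      ‖g x - g y‖ ≤ 2 * min τ ‖f x - f y‖ := by
  -- The Gaussian map saturates at scale 1, so `f` is rescaled by `τ⁻¹` before it and by `τ` after
  -- it.
  obtain ⟨g, hg⟩ := exists_gaussian_map fun x => τ⁻¹ • f x
  refine ⟨fun x => τ • g x, fun x y => ?_⟩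
  have h := hg x y
  rw [← smul_sub, norm_smul, norm_inv, Real.norm_of_nonneg hτ.le] at h
  rw [← smul_sub, norm_smul, Real.norm_of_nonneg hτ.le]
  set e := ‖f x - f y‖ with he
  have he0 : 0 ≤ e := norm_nonneg _
  set r := τ⁻¹ * e with hr
  have hr0 : 0 ≤ r := by positivity
  have her : e = τ * r := by rw [hr, mul_inv_cancel_left₀ hτ.ne']
  have hm : min τ e = τ * min 1 r := by
    rw [her, mul_min_of_nonneg _ _ hτ.le, mul_one]
  have hm0 : 0 ≤ min 1 r := le_min zero_le_one hr0
  have hlow := half_min_one_le_one_sub_exp (show 0 ≤ r ^ 2 / 2 by positivity)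
  have hup1 := Real.add_one_le_exp (-(r ^ 2 / 2))
  have hup2 := Real.exp_pos (-(r ^ 2 / 2))
  have hn := norm_nonneg (g x - g y)
  rw [hm]
  constructor
  · rw [mul_left_comm]
    refine mul_le_mul_of_nonneg_left (abs_le_of_sq_le_sq' ?_ (by positivity)).2 hτ.le
    rw [mul_pow, h]
    rcases le_total 1 r with h1 | h1
    · rw [min_eq_left h1]
      have : (1 : ℝ) / 2 ≤ min 1 (r ^ 2 / 2) := le_min (by norm_num) (by nlinarith)
      linarith
    · rw [min_eq_right h1]
      have : r ^ 2 / 2 ≤ min 1 (r ^ 2 / 2) := le_min (by nlinarith) le_rfl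
      linarith
  · rw [mul_left_comm]
    refine mul_le_mul_of_nonneg_left (abs_le_of_sq_le_sq' ?_ (by positivity)).2 hτ.le
    rw [mul_pow, h]
    rcases le_total 1 r with h1 | h1
    · rw [min_eq_left h1]
      linarith
    · rw [min_eq_right h1]
      nlinarith

/-- A map to a Hilbert space that is Lipschitz and has a lower control function, which is affine
if `aff` holds. -/
def LipschitzEmbedding (aff : Prop) {X : Type u} (d : X → X → ℝ) : Prop :=
  ∃ (H : Type u) (_ : NormedAddCommGroup H) (_ : InnerProductSpace ℝ H) (_ : CompleteSpace H)
    (f : X → H) (L : ℝ), (∀ x y, ‖f x - f y‖ ≤ L * d x y) ∧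
    ∃ φ, Controlled aff φ ∧ ∀ x y, d x y ≤ φ ‖f x - f y‖

theorem LipschitzEmbedding.embedsCoarsely {X : Type u} {d : X → X → ℝ} {aff : Prop}
    (hd : ∀ x y, 0 ≤ d x y) (h : LipschitzEmbedding aff d) : EmbedsCoarsely d := by
  obtain ⟨H, i1, i2, i3, f, L, hf, hφ⟩ := h
  refine ControlledEmbedding.embedsCoarsely (aff := aff)
    ⟨H, i1, i2, i3, f, fun R => ⟨|L| * R, fun x y hxy => (hf x y).trans ?_⟩, hφ⟩
  exact mul_le_mul (le_abs_self L) hxy (hd x y) (abs_nonneg L)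

theorem LipschitzEmbedding.embedsQuasiIsometrically {X : Type u} {d : X → X → ℝ}
    (hd : ∀ x y, 0 ≤ d x y) (h : LipschitzEmbedding True d) : EmbedsQuasiIsometrically d := by
  obtain ⟨H, i1, i2, i3, f, L, hf, φ, hφ, h⟩ := h
  exact embedsQuasiIsometrically_of_controlled hd (C := 0)
    (fun x y => (hf x y).trans_eq (add_zero _).symm) hφ h

/-- The finite quotients embed into one Hilbert space with common control functions. -/
def UniformEmbedding (aff : Prop) {Γ : Type u} [Group Γ] (S : Finset Γ) (N : ℕ → Subgroup Γ)
    [∀ n, (N n).Normal] : Prop :=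
  ∃ (H : Type u) (_ : NormedAddCommGroup H) (_ : InnerProductSpace ℝ H) (_ : CompleteSpace H)
    (f : ∀ n, Γ ⧸ N n → H) (L : ℝ),
    (0 ≤ L ∧ ∀ n g h, ‖f n g - f n h‖ ≤ L * quotientDist S (N n) g h) ∧
    ∃ φ, Controlled aff φ ∧ ∀ n g h, (quotientDist S (N n) g h : ℝ) ≤ φ ‖f n g - f n h‖

/-! ### Embeddings of the levels of the warped cone -/

theorem norm_toLp_prod_le {E F : Type*} [SeminormedAddCommGroup E] [SeminormedAddCommGroup F]
    (x : E) (y : F) : ‖WithLp.toLp 2 (x, y)‖ ≤ ‖x‖ + ‖y‖ := by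
  refine abs_le_of_sq_le_sq' ?_ (by positivity) |>.2
  have : 0 ≤ ‖x‖ * ‖y‖ := by positivity
  rw [WithLp.prod_norm_sq_eq_of_L2, WithLp.toLp_fst, WithLp.toLp_snd]
  nlinarith

/-- Since ρ is comparable to δ₀ + min(τ, δ₁), the sum of `e` and the truncation of `f` at `τ` embeds
it. In `6 * L + 4`, the part `2 * L` comes from `e` and `4 * (L + 1)` from the truncation. -/
theorem exists_map_of_min_estimates {X Y H : Type*} [Fintype X] [NormedAddCommGroup H]
    [InnerProductSpace ℝ H] {ρ δ₀ : Y → Y → ℝ} {δ₁ : X → X → ℝ} (π : Y → X) {τ L : ℝ}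
    (hτ : 0 < τ) (hL : 0 ≤ L) {aff : Prop} {φ : ℝ → ℝ} (hφ : Controlled aff φ) {e : Y → H}
    {f : X → H}
    (he : ∀ y z, ‖e y - e z‖ ≤ L * δ₀ y z) (he' : ∀ y z, δ₀ y z ≤ φ ‖e y - e z‖)
    (hf : ∀ y z, ‖f y - f z‖ ≤ L * δ₁ y z) (hf' : ∀ y z, δ₁ y z ≤ φ ‖f y - f z‖)
    (hδ : ∀ y z, 0 ≤ δ₁ y z)
    (h₀ : ∀ y z, δ₀ y z / 2 ≤ ρ y z) (h₁ : ∀ y z, min (δ₁ (π y) (π z)) (τ / 2) ≤ ρ y z)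
    (h₂ : ∀ y z, ρ y z ≤ δ₀ y z + min τ (δ₁ (π y) (π z)) + 1) :
    ∃ F : Y → WithLp 2 (H × EuclideanSpace ℝ X),
      (∀ y z, ‖F y - F z‖ ≤ (6 * L + 4) * ρ y z) ∧
      ∀ y z, ρ y z ≤ 2 * φ (2 * ‖F y - F z‖) + 2 * max ‖F y - F z‖ 0 + 1 := by
  obtain ⟨g, hg⟩ := exists_truncation f hτ
  refine ⟨fun y => WithLp.toLp 2 (e y, g (π y)), fun y z => ?_, fun y z => ?_⟩
  · rw [← WithLp.toLp_sub, Prod.mk_sub_mk]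
    have h1 : ‖WithLp.toLp 2 (e y - e z, g (π y) - g (π z))‖ ≤
        ‖e y - e z‖ + ‖g (π y) - g (π z)‖ := norm_toLp_prod_le _ _
    -- Either `δ₁ ≤ τ / 2`, so `δ₁ ≤ ρ`, or `τ ≤ 2 * ρ`.
    have h2 : min τ ‖f (π y) - f (π z)‖ ≤ 2 * (L + 1) * ρ y z := by
      rcases le_total (δ₁ (π y) (π z)) (τ / 2) with h | h
      · have h3 := h₁ y z
        rw [min_eq_left h] at h3
        have := hδ (π y) (π z)
        have := mul_le_mul_of_nonneg_left h3 hL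
        have := mul_nonneg hL (hδ (π y) (π z))
        refine (min_le_right _ _).trans ?_
        nlinarith [hf (π y) (π z)]
      · have h3 := h₁ y z
        rw [min_eq_right h] at h3
        have := mul_nonneg hL (show 0 ≤ ρ y z by linarith)
        refine (min_le_left _ _).trans ?_
        nlinarith
    have h3 := mul_le_mul_of_nonneg_left (h₀ y z) hL
    linarith [he y z, (hg (π y) (π z)).2]
  · rw [← WithLp.toLp_sub, Prod.mk_sub_mk]
    set v : WithLp 2 (H × EuclideanSpace ℝ X) := WithLp.toLp 2 (e y - e z, g (π y) - g (π z))
    have h1 : ‖e y - e z‖ ≤ ‖v‖ := WithLp.norm_fst_le _ v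
    have h2 : ‖g (π y) - g (π z)‖ ≤ ‖v‖ := WithLp.norm_snd_le _ v
    have hv := norm_nonneg v
    rw [max_eq_left hv]
    have h3 : δ₀ y z ≤ φ (2 * ‖v‖) := (he' y z).trans (hφ.mono (by linarith))
    have h4 : min τ (δ₁ (π y) (π z)) ≤ 2 * ‖v‖ + φ (2 * ‖v‖) := by
      have h5 := (hg (π y) (π z)).1
      rcases min_le_iff.1 h5 with h | h
      · exact (min_le_left _ _).trans (by linarith [hφ.nonneg (2 * ‖v‖)])
      · refine (min_le_right _ _).trans ?_
        have := hφ.mono (h.trans (by linarith : 2 * ‖g (π y) - g (π z)‖ ≤ 2 * ‖v‖))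
        linarith [hf' (π y) (π z)]
    linarith [h₂ y z]

theorem exists_level_map {Γ : Type u} [Group Γ] {S : Finset Γ}
    (hS : Subgroup.closure (S : Set Γ) = ⊤)
    {N : ℕ → Subgroup Γ} [∀ n, (N n).Normal] [∀ n, (N n).FiniteIndex]
    [∀ n, Fintype (Γ ⧸ N n)] {hN : Antitone N}
    {a : ℕ → ℝ} (ha : ∀ n, 0 < a n) (ha0 : Tendsto a atTop (𝓝 0))
    (hdiam : ∀ g h : completion N hN, completionDist a g h ≤ 2)
    (hconv : ∀ n, a (n + 1) * (quotientDiam S (N n) : ℝ) < a n)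
    {H : Type u} [NormedAddCommGroup H] [InnerProductSpace ℝ H] {f : ∀ n, Γ ⧸ N n → H} {L : ℝ}
    (hL : 0 ≤ L) (hf : ∀ n g h, ‖f n g - f n h‖ ≤ L * quotientDist S (N n) g h)
    {aff : Prop} {φ : ℝ → ℝ} (hφ : Controlled aff φ)
    (hf' : ∀ n g h, (quotientDist S (N n) g h : ℝ) ≤ φ ‖f n g - f n h‖) {t : ℝ} (ht : 1 ≤ t) :
    ∃ (n : ℕ) (F : completion N hN → WithLp 2 (H × EuclideanSpace ℝ (Γ ⧸ N n))),
      (∀ y z, ‖F y - F z‖ ≤ (6 * L + 4) * levelDist S (completionDist a) t y z) ∧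
      ∀ y z, levelDist S (completionDist a) t y z ≤
        2 * φ (2 * ‖F y - F z‖) + 2 * max ‖F y - F z‖ 0 + 1 := by
  have hd := completionDist_nonneg (N := N) (hN := hN) ha
  have hρ := levelDist_isPseudoMetric (S := S) hd t
  have ht0 : 0 < t := zero_lt_one.trans_le ht
  by_cases hex : ∃ n, N n ≠ ⊤
  swap
  · push Not at hex
    have hsub : ∀ y z : completion N hN, y = z := fun y z => by
      refine Subtype.ext (funext fun n => ?_)
      have : Subsingleton (Γ ⧸ N n) := by
        rw [hex n]; exact QuotientGroup.subsingleton_quotient_top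
      exact Subsingleton.elim _ _
    refine ⟨0, fun _ => 0, fun y z => ?_, fun y z => ?_⟩
    · rw [hsub y z, hρ.refl, sub_self, norm_zero, mul_zero]
    · rw [hsub y z, hρ.refl, sub_self, norm_zero, max_self, mul_zero, add_zero]
      linarith [hφ.nonneg 0, hφ.nonneg (2 * 0)]
  classical
  obtain ⟨n₀, hn₀, hmin₀⟩ : ∃ n₀, N n₀ ≠ ⊤ ∧ ∀ m, N m ≠ ⊤ → n₀ ≤ m :=
    ⟨Nat.find hex, Nat.find_spec hex, fun m => Nat.find_min' hex⟩
  -- The least such `n` is used: G_n determines the level up to an additive 1, while minimality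
  -- keeps `t * a n > 1` when `n > n₀`.
  have hexn : ∃ n, n₀ ≤ n ∧ t * a (n + 1) ≤ 1 := by
    have h1 : Tendsto (fun n => t * a (n + 1)) atTop (𝓝 (t * 0)) :=
      ((tendsto_add_atTop_iff_nat 1).2 ha0).const_mul t
    rw [mul_zero] at h1
    obtain ⟨n, hn⟩ := ((h1.eventually_le_const zero_lt_one).and
      (eventually_ge_atTop n₀)).exists
    exact ⟨n, hn.2, hn.1⟩
  obtain ⟨n, hn, hmin⟩ : ∃ n, (n₀ ≤ n ∧ t * a (n + 1) ≤ 1) ∧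
      ∀ m < n, ¬(n₀ ≤ m ∧ t * a (m + 1) ≤ 1) :=
    ⟨Nat.find hexn, Nat.find_spec hexn, fun m => Nat.find_min hexn⟩
  have hnt : N n ≠ ⊤ := ne_top_of_le hN hn.1 hn₀
  have hlow := fun n y z => min_quotientDist_le_levelDist hS ha ha0 hdiam n ht y z
  have hup : ∀ y z : completion N hN, levelDist S (completionDist a) t y z ≤
      quotientDist S (N n) (y.1 n) (z.1 n) + 1 := fun y z =>
    (levelDist_le_quotientDist_add hS ha hconv hnt ht y z).trans (by linarith [hn.2])
  have hτ : 0 < t * a n := mul_pos ht0 (ha n)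
  refine ⟨n, ?_⟩
  -- If `n = n₀`, there is no coarser nontrivial quotient: δ₀ is zero, and the level has diameter at
  -- most `t * a n`.
  rcases hn.1.eq_or_lt with h | h
  · refine exists_map_of_min_estimates (X := Γ ⧸ N n) (Y := completion N hN)
      (ρ := levelDist S (completionDist a) t) (δ₀ := fun _ _ => 0) (e := fun _ => 0)
      (δ₁ := fun g h => quotientDist S (N n) g h) (f := f n) (fun y => y.1 n) hτ hL hφ
      (fun y z => by simp) (fun y z => hφ.nonneg _) (hf n) (hf' n) (fun _ _ => Nat.cast_nonneg _)
      (fun y z => by simpa using hρ.nonneg y z) (fun y z => hlow n y z) fun y z => ?_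
    rw [zero_add, ← min_add_add_right]
    refine le_min ?_ (hup y z)
    have h1 := levelDist_le (S := S) hd ht y z
    have h2 : completionDist a y z ≤ a n := completionDist_le (ha n).le fun m hm => by
      have hm' : N m ≠ ⊤ := fun hm' => hm (by
        have : Subsingleton (Γ ⧸ N m) := by
          rw [hm']; exact QuotientGroup.subsingleton_quotient_top
        exact Subsingleton.elim _ _)
      rw [← h]
      exact le_of_le_of_ne_top hN hS ha hconv (hmin₀ m hm') hn₀
    have h3 := mul_le_mul_of_nonneg_left h2 ht0.le
    linarith
  · obtain ⟨m, hm⟩ : ∃ m, n = m + 1 := ⟨n - 1, by omega⟩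
    have hmt : N m ≠ ⊤ := ne_top_of_le hN (by omega) hn₀
    have hmn : 1 < t * a n := by
      by_contra! hle
      exact hmin m (by omega) ⟨by omega, by rwa [← hm]⟩
    refine exists_map_of_min_estimates (X := Γ ⧸ N n) (Y := completion N hN)
      (ρ := levelDist S (completionDist a) t)
      (δ₁ := fun g h => quotientDist S (N n) g h) (f := f n)
      (δ₀ := fun y z => quotientDist S (N m) (y.1 m) (z.1 m))
      (e := fun y => f m (y.1 m)) (fun y => y.1 n) hτ hL hφ (fun y z => hf m _ _)
      (fun y z => hf' m _ _) (hf n) (hf' n) (fun _ _ => Nat.cast_nonneg _)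
      (fun y z => ?_) (fun y z => hlow n y z) fun y z => ?_
    -- Here `t * a m ≥ t * a n * diam G_m ≥ diam G_m`, so the minimum in the lower estimate loses at
    -- most a factor 2.
    · refine le_trans (le_min ?_ ?_) (hlow m y z)
      · have : (0 : ℝ) ≤ quotientDist S (N m) (y.1 m) (z.1 m) := Nat.cast_nonneg _
        linarith
      · have h1 : (quotientDist S (N m) (y.1 m) (z.1 m) : ℝ) ≤ quotientDiam S (N m) := by
          exact_mod_cast quotientDist_le_quotientDiam (N m) _ _
        have h2 := mul_le_mul_of_nonneg_left (hconv m).le ht0.le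
        have h3 : (0 : ℝ) ≤ quotientDiam S (N m) := Nat.cast_nonneg _
        rw [← mul_assoc, ← hm] at h2
        nlinarith
    · have h1 := levelDist_le_quotientDist_add hS ha hconv hmt ht y z
      rw [← hm] at h1
      have h2 := hup y z
      have h3 : (0 : ℝ) ≤ quotientDist S (N m) (y.1 m) (z.1 m) := Nat.cast_nonneg _
      rcases min_choice (t * a n) (quotientDist S (N n) (y.1 n) (z.1 n) : ℝ) with h | h <;>
        rw [h] <;> linarith

/-! ### Gluing embeddings of the levels -/

/-- The piecewise linear bump function supported on `[1/2, 2]` with value `1` at `1`. -/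
def tent (x : ℝ) : ℝ := max 0 (min (2 * x - 1) (2 - x))

theorem tent_of_le_half {x : ℝ} (h : x ≤ 1 / 2) : tent x = 0 :=
  max_eq_left ((min_le_left _ _).trans (by linarith))

theorem tent_of_two_le {x : ℝ} (h : 2 ≤ x) : tent x = 0 :=
  max_eq_left ((min_le_right _ _).trans (by linarith))

theorem tent_nonneg (x : ℝ) : 0 ≤ tent x := le_max_left _ _

theorem tent_le_one (x : ℝ) : tent x ≤ 1 := by
  refine max_le zero_le_one ?_
  rcases le_total x 1 with h | h
  · exact (min_le_left _ _).trans (by linarith)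
  · exact (min_le_right _ _).trans (by linarith)

theorem abs_tent_sub_tent_le (x y : ℝ) : |tent x - tent y| ≤ 2 * |x - y| := by
  refine (abs_max_sub_max_le_max _ _ _ _).trans (max_le (by simp) ?_)
  refine (abs_min_sub_min_le_max _ _ _ _).trans (max_le ?_ ?_)
  · rw [show 2 * x - 1 - (2 * y - 1) = 2 * (x - y) by ring, abs_mul, abs_two]
  · rw [show 2 - x - (2 - y) = -(x - y) by ring, abs_neg]
    linarith [abs_nonneg (x - y)]

theorem half_le_tent {x : ℝ} (h1 : 1 ≤ x) (h2 : x ≤ 2) :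
    1 / 2 ≤ tent x ∨ 1 / 2 ≤ tent (x / 2) := by
  rcases le_total x (3 / 2) with h | h
  · exact Or.inl (le_max_of_le_right (le_min (by linarith) (by linarith)))
  · exact Or.inr (le_max_of_le_right (le_min (by linarith) (by linarith)))

section Glue

variable {Y : Type*} {E : ℕ → Type u} [∀ j, NormedAddCommGroup (E j)]
  [∀ j, InnerProductSpace ℝ (E j)]

/-- The sum of the maps `F j`, cut off by tents around the levels `2 ^ j`. Here `k` is the
integer part of the binary logarithm of `t`. -/
def tentSum (F : ∀ j, Y → E j) (k : ℕ) (t : ℝ) (y : Y) : lp E 2 :=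
  ∑ j ∈ {k, k + 1}, lp.single 2 j (tent (t / 2 ^ j) • F j y)

variable {F : ∀ j, Y → E j} {k : ℕ} {t : ℝ}

/-- Thus `tentSum` is the full sum over all `j`, and sums at different heights can be compared over
a common index set. -/
theorem tent_div_eq_zero (h1 : 2 ^ k ≤ t) (h2 : t < 2 ^ (k + 1)) {j : ℕ}
    (hj : j ∉ ({k, k + 1} : Finset ℕ)) : tent (t / 2 ^ j) = 0 := by
  simp only [Finset.mem_insert, Finset.mem_singleton, not_or] at hj
  rcases lt_or_ge j k with h | h
  · refine tent_of_two_le ?_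
    rw [le_div_iff₀ (by positivity), ← pow_succ']
    exact (pow_le_pow_right₀ one_le_two h).trans h1
  · refine tent_of_le_half ?_
    rw [div_le_iff₀ (by positivity)]
    have : (2 : ℝ) ^ (k + 2) ≤ 2 ^ j := pow_le_pow_right₀ one_le_two (by omega)
    rw [show k + 2 = k + 1 + 1 from rfl, pow_succ 2 (k + 1)] at this
    linarith

/-- At most four indices matter. For each, the slope `2 / 2 ^ j` of the tent cancels the growth `B *
2 ^ j` of `F j`. -/
theorem norm_tentSum_sub_tentSum_level_le {B : ℝ} (hF : ∀ j y, ‖F j y‖ ≤ B * 2 ^ j)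
    (h1 : 2 ^ k ≤ t) (h2 : t < 2 ^ (k + 1)) {k' : ℕ} {t' : ℝ} (h1' : 2 ^ k' ≤ t')
    (h2' : t' < 2 ^ (k' + 1)) (y : Y) :
    ‖tentSum F k t y - tentSum F k' t' y‖ ≤ 8 * B * |t - t'| := by
  have hB : 0 ≤ B := by simpa using (norm_nonneg _).trans (hF 0 y)
  set J : Finset ℕ := {k, k + 1} ∪ {k', k' + 1} with hJ
  have e1 : tentSum F k t y = ∑ j ∈ J, lp.single 2 j (tent (t / 2 ^ j) • F j y) :=
    Finset.sum_subset Finset.subset_union_left fun j _ hj => by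
      rw [tent_div_eq_zero h1 h2 hj, zero_smul, lp.single_zero]
  have e2 : tentSum F k' t' y = ∑ j ∈ J, lp.single 2 j (tent (t' / 2 ^ j) • F j y) :=
    Finset.sum_subset Finset.subset_union_right fun j _ hj => by
      rw [tent_div_eq_zero h1' h2' hj, zero_smul, lp.single_zero]
  have hcard : J.card ≤ 4 :=
    (Finset.card_union_le _ _).trans (add_le_add Finset.card_le_two Finset.card_le_two)
  rw [e1, e2, ← Finset.sum_sub_distrib]
  refine (norm_sum_le_of_le J (f := fun j => lp.single 2 j (tent (t / 2 ^ j) • F j y) -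
    lp.single 2 j (tent (t' / 2 ^ j) • F j y)) (n := fun _ => 2 * B * |t - t'|)
    fun j _ => ?_).trans ?_
  · rw [← lp.single_sub, ← sub_smul, lp.norm_single (by norm_num), norm_smul, Real.norm_eq_abs]
    refine (mul_le_mul (abs_tent_sub_tent_le _ _) (hF j y) (norm_nonneg _)
      (by positivity)).trans_eq ?_
    rw [← sub_div, abs_div, abs_of_pos (by positivity : (0 : ℝ) < 2 ^ j)]
    field_simp
  · rw [Finset.sum_const, nsmul_eq_mul]
    have : (J.card : ℝ) ≤ 4 := by exact_mod_cast hcard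
    have h3 : 0 ≤ 2 * B * |t - t'| := by positivity
    nlinarith

theorem norm_tentSum_sub_tentSum_le (y z : Y) :
    ‖tentSum F k t y - tentSum F k t z‖ ≤ ‖F k y - F k z‖ + ‖F (k + 1) y - F (k + 1) z‖ := by
  have h : ∀ j, ‖lp.single (E := E) 2 j (tent (t / 2 ^ j) • F j y) -
      lp.single 2 j (tent (t / 2 ^ j) • F j z)‖ ≤ ‖F j y - F j z‖ := fun j => by
    rw [← lp.single_sub, ← smul_sub, lp.norm_single (by norm_num), norm_smul,
      Real.norm_of_nonneg (tent_nonneg _)]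
    exact mul_le_of_le_one_left (norm_nonneg _) (tent_le_one _)
  rw [tentSum, tentSum, ← Finset.sum_sub_distrib, Finset.sum_pair (by omega)]
  exact (norm_add_le _ _).trans (add_le_add (h _) (h _))

theorem tent_mul_norm_le {j : ℕ} (hj : j ∈ ({k, k + 1} : Finset ℕ)) (y z : Y) :
    tent (t / 2 ^ j) * ‖F j y - F j z‖ ≤ ‖tentSum F k t y - tentSum F k t z‖ := by
  have h : ∀ y, tentSum F k t y j = tent (t / 2 ^ j) • F j y := fun y => by
    rw [tentSum, lp.coeFn_sum, Finset.sum_apply]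
    simp only [lp.single_apply]
    rw [Finset.sum_pi_single, if_pos hj]
  have := lp.norm_apply_le_norm (E := E) (p := 2) (by norm_num)
    (tentSum F k t y - tentSum F k t z) j
  rwa [lp.coeFn_sub, Pi.sub_apply, h, h, ← smul_sub, norm_smul,
    Real.norm_of_nonneg (tent_nonneg _)] at this

end Glue

/-- Two points are compared by moving the second vertically to the height of the first. The height
coordinate controls this move, and the tent sum controls the distance within the level. -/
theorem lipschitzEmbedding_warpedConeDist {Γ : Type*} {Y : Type u} [Group Γ] [MulAction Γ Y]
    {S : Finset Γ} {d : Y → Y → ℝ} (hd : ∀ x y, 0 ≤ d x y) (hd0 : ∀ y, d y y = 0)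
    (hd2 : ∀ x y, d x y ≤ 2) [Nonempty Y]
    {E : ℕ → Type u} [∀ j, NormedAddCommGroup (E j)] [∀ j, InnerProductSpace ℝ (E j)]
    [∀ j, CompleteSpace (E j)] (F : ∀ j, Y → E j) {A : ℝ} (hA : 0 ≤ A)
    (hF : ∀ j y z, ‖F j y - F j z‖ ≤ A * levelDist S d (2 ^ j) y z) {aff : Prop} {φ : ℝ → ℝ}
    (hφ : Controlled aff φ) (hF' : ∀ j y z, levelDist S d (2 ^ j) y z ≤ φ ‖F j y - F j z‖) :
    LipschitzEmbedding aff (warpedConeDist S d : Cone Y → Cone Y → ℝ) := by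
  obtain ⟨y₀⟩ := ‹Nonempty Y›
  -- Basing the maps at `y₀` bounds them by a multiple of `2 ^ j`, as the level `2 ^ j` has diameter
  -- at most `2 * 2 ^ j`.
  let F₀ : ∀ j, Y → E j := fun j y => F j y - F j y₀
  have hsub : ∀ j y z, F₀ j y - F₀ j z = F j y - F j z := fun j y z =>
    sub_sub_sub_cancel_right _ _ _
  have hpow : ∀ j : ℕ, (1 : ℝ) ≤ 2 ^ j := fun j => one_le_pow₀ one_le_two
  have hF₀ : ∀ j y, ‖F₀ j y‖ ≤ 2 * A * 2 ^ j := fun j y => by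
    have h1 := levelDist_le (S := S) hd (hpow j) y y₀
    have h2 := mul_le_mul_of_nonneg_left (hd2 y y₀) (zero_le_one.trans (hpow j))
    have h3 := mul_le_mul_of_nonneg_left (h1.trans h2) hA
    exact (hF j y y₀).trans (by linarith)
  have hk : ∀ p : Cone Y, ∃ k : ℕ, (2 : ℝ) ^ k ≤ p.1 ∧ (p.1 : ℝ) < 2 ^ (k + 1) := fun p =>
    exists_nat_pow_near p.1.2 one_lt_two
  choose k hk1 hk2 using hk
  let G : Cone Y → lp E 2 := fun p => tentSum F₀ (k p) p.1 p.2
  -- the point at the level of `p` below or above `q`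
  let m : Cone Y → Cone Y → lp E 2 := fun p q => tentSum F₀ (k p) p.1 q.2
  have hW := isWarping_warpedConeDist (S := S) hd
  have hm1 : ∀ p q, ‖m p q - G q‖ ≤ 8 * (2 * A) * |(p.1 : ℝ) - q.1| := fun p q =>
    norm_tentSum_sub_tentSum_level_le hF₀ (hk1 p) (hk2 p) (hk1 q) (hk2 q) q.2
  have habs := abs_sub_le_warpedConeDist (S := S) hd
  have hlev1 : ∀ p q : Cone Y, levelDist S d p.1 p.2 q.2 ≤
      warpedConeDist S d p q + |(p.1 : ℝ) - q.1| := fun p q => by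
    have h1 := hW.pseudo.triangle p q (conePoint (p.1 : ℝ) q.2)
    have h2 := warpedConeDist_vertical_le (S := S) hd hd0 q.1.2 p.1.2 q.2
    rw [conePoint_coe, abs_sub_comm] at h2
    rw [levelDist, conePoint_coe]
    linarith
  have hlev2 : ∀ p q : Cone Y, warpedConeDist S d p q ≤
      levelDist S d p.1 p.2 q.2 + |(p.1 : ℝ) - q.1| := fun p q => by
    have h1 := hW.pseudo.triangle p (conePoint (p.1 : ℝ) q.2) q
    have h2 := warpedConeDist_vertical_le (S := S) hd hd0 p.1.2 q.1.2 q.2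
    rw [conePoint_coe] at h2
    rw [levelDist, conePoint_coe]
    linarith
  have hup : ∀ p q, ‖G p - m p q‖ ≤ 3 * A * levelDist S d p.1 p.2 q.2 := fun p q => by
    have h1 := norm_tentSum_sub_tentSum_le (F := F₀) (k := k p) (t := p.1) p.2 q.2
    rw [hsub, hsub] at h1
    have h2 := levelDist_mono (S := S) hd (hpow _) (hk1 p) p.2 q.2
    have h3 := levelDist_mul_le (S := S) hd (hpow (k p)) one_le_two p.2 q.2
    rw [← pow_succ'] at h3
    have h4 := mul_le_mul_of_nonneg_left h2 hA
    have h5 := mul_le_mul_of_nonneg_left h3 hA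
    linarith [hF (k p) p.2 q.2, hF (k p + 1) p.2 q.2]
  have hlow : ∀ p q, levelDist S d p.1 p.2 q.2 ≤ 2 * φ (2 * ‖G p - m p q‖) := fun p q => by
    have hx1 : 1 ≤ (p.1 : ℝ) / 2 ^ k p := by
      rw [le_div_iff₀ (by positivity), one_mul]
      exact hk1 p
    have hx2 : (p.1 : ℝ) / 2 ^ k p ≤ 2 := by
      rw [div_le_iff₀ (by positivity), ← pow_succ']
      exact (hk2 p).le
    have key : ∀ j ∈ ({k p, k p + 1} : Finset ℕ), 1 / 2 ≤ tent ((p.1 : ℝ) / 2 ^ j) →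
        levelDist S d (2 ^ j) p.2 q.2 ≤ φ (2 * ‖G p - m p q‖) := fun j hj ht => by
      refine (hF' j _ _).trans (hφ.mono ?_)
      have h1 := tent_mul_norm_le (F := F₀) (t := p.1) hj p.2 q.2
      rw [hsub] at h1
      change _ ≤ ‖G p - m p q‖ at h1
      have h2 := mul_le_mul_of_nonneg_right ht (norm_nonneg (F j p.2 - F j q.2))
      linarith
    -- One of the two active tents is at least 1/2. At `2 ^ k` the level is compared by scaling, at
    -- `2 ^ (k + 1)` by monotonicity.
    rcases half_le_tent hx1 hx2 with h | h
    · have h1 := key _ (by simp) h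
      have h2 := levelDist_mul_le (S := S) hd (hpow (k p)) hx1 p.2 q.2
      rw [div_mul_cancel₀ _ (by positivity)] at h2
      have h3 := (levelDist_isPseudoMetric (S := S) hd (2 ^ k p)).nonneg p.2 q.2
      have h4 := mul_le_mul_of_nonneg_right hx2 h3
      linarith
    · rw [div_div, ← pow_succ] at h
      have h1 := key _ (by simp) h
      have h2 := levelDist_mono (S := S) hd p.1.2 (hk2 p).le p.2 q.2
      linarith [hφ.nonneg (2 * ‖G p - m p q‖)]
  refine ⟨WithLp 2 (lp E 2 × ℝ), inferInstance, inferInstance, inferInstance,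
    fun p => WithLp.toLp 2 (G p, (p.1 : ℝ)), 1 + 22 * A, fun p q => ?_,
    fun r => 2 * φ (2 * (16 * A + 1) * r) + 1 * max r 0 + 0,
    hφ.comp zero_le_two (by positivity) zero_le_one le_rfl, fun p q => ?_⟩
  · rw [← WithLp.toLp_sub, Prod.mk_sub_mk]
    have h1 : ‖WithLp.toLp 2 (G p - G q, (p.1 : ℝ) - q.1)‖ ≤ ‖G p - G q‖ + |(p.1 : ℝ) - q.1| :=
      norm_toLp_prod_le _ _
    have h2 := norm_sub_le_norm_sub_add_norm_sub (G p) (m p q) (G q)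
    have h3 := mul_le_mul_of_nonneg_left (habs p q) hA
    have h4 := mul_le_mul_of_nonneg_left (hlev1 p q) hA
    linarith [hup p q, hm1 p q, habs p q]
  · rw [← WithLp.toLp_sub, Prod.mk_sub_mk]
    set v : WithLp 2 (lp E 2 × ℝ) := WithLp.toLp 2 (G p - G q, (p.1 : ℝ) - q.1)
    have h1 : ‖G p - G q‖ ≤ ‖v‖ := WithLp.norm_fst_le _ v
    have h2 : |(p.1 : ℝ) - q.1| ≤ ‖v‖ := WithLp.norm_snd_le _ v
    have h3 := norm_sub_le_norm_sub_add_norm_sub (G p) (G q) (m p q)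
    rw [norm_sub_rev (G q)] at h3
    have h4 := mul_le_mul_of_nonneg_left h2 hA
    have h5 : 2 * ‖G p - m p q‖ ≤ 2 * (16 * A + 1) * ‖v‖ := by linarith [hm1 p q]
    have h6 := hφ.mono h5
    dsimp only
    rw [max_eq_left (norm_nonneg v)]
    linarith [hlow p q, hlev2 p q]

section Main

variable {Γ : Type u} [Group Γ] {S : Finset Γ} {N : ℕ → Subgroup Γ} [∀ n, (N n).Normal]
  {aff : Prop}

/-! ### From uniform embeddings of the quotients to the warped cone, and back -/

theorem UniformEmbedding.lipschitzEmbedding_warpedConeDist [∀ n, (N n).FiniteIndex]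
    (h : UniformEmbedding aff S N) (hS : Subgroup.closure (S : Set Γ) = ⊤) {hN : Antitone N}
    {a : ℕ → ℝ} (ha : ∀ n, 0 < a n) (ha0 : Tendsto a atTop (𝓝 0))
    (hdiam : ∀ g h : completion N hN, completionDist a g h ≤ 2)
    (hconv : ∀ n, a (n + 1) * (quotientDiam S (N n) : ℝ) < a n) :
    LipschitzEmbedding aff (warpedConeDist S (completionDist (N := N) (hN := hN) a)) := by
  obtain ⟨H, i1, i2, i3, f, L, ⟨hL, hf⟩, φ, hφ, hf'⟩ := h
  have : ∀ n, Fintype (Γ ⧸ N n) := fun n => Fintype.ofFinite _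
  choose n F hF1 hF2 using fun j : ℕ => exists_level_map hS ha ha0 hdiam hconv hL hf hφ hf'
    (one_le_pow₀ (M₀ := ℝ) one_le_two : (1 : ℝ) ≤ 2 ^ j)
  exact WarpedBox.lipschitzEmbedding_warpedConeDist (completionDist_nonneg ha) completionDist_self
    hdiam F (A := 6 * L + 4) (by positivity) hF1
    (φ := fun r => 2 * φ (2 * r) + 2 * max r 0 + 1)
    (hφ.comp zero_le_two zero_le_two zero_le_two zero_le_one) hF2

theorem exists_level_section [∀ n, (N n).FiniteIndex] (hS : Subgroup.closure (S : Set Γ) = ⊤)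
    {hN : Antitone N}
    {a : ℕ → ℝ} (ha : ∀ n, 0 < a n) (ha0 : Tendsto a atTop (𝓝 0))
    (hdiam : ∀ g h : completion N hN, completionDist a g h ≤ 2)
    (hconv : ∀ n, a (n + 1) * (quotientDiam S (N n) : ℝ) < a n) (n : ℕ) :
    ∃ ι : Γ ⧸ N n → Cone (completion N hN), ∀ g h,
      (quotientDist S (N n) g h : ℝ) ≤ 2 * warpedConeDist S (completionDist a) (ι g) (ι h) ∧
      warpedConeDist S (completionDist a) (ι g) (ι h) ≤ quotientDist S (N n) g h + 2 := by
  have hd := completionDist_nonneg (N := N) (hN := hN) ha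
  by_cases hn : N n = ⊤
  · refine ⟨fun _ => conePoint 1 1, fun g h => ?_⟩
    have : Subsingleton (Γ ⧸ N n) := by rw [hn]; exact QuotientGroup.subsingleton_quotient_top
    rw [Subsingleton.elim g h, (isWarping_warpedConeDist (S := S) hd).pseudo.refl,
      (quotientDist_isPseudoMetric hS (N n)).refl]
    norm_num
  -- At this height `t * a n ≥ diam G_n`, so the lower estimate is not cut off, and `t * a (n + 1) ≤
  -- 2`.
  set t := max 1 (a (n + 1))⁻¹ with ht
  have ht1 : 1 ≤ t := le_max_left _ _
  have ht2 : (a (n + 1))⁻¹ ≤ t := le_max_right _ _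
  have hpos := ha (n + 1)
  refine ⟨fun g => conePoint t (toCompletion N hN g.out), fun g h => ?_⟩
  have hout : ∀ g : Γ ⧸ N n, (toCompletion N hN g.out).1 n = g := fun g => QuotientGroup.out_eq' g
  constructor
  · have h1 := min_quotientDist_le_levelDist hS ha ha0 hdiam n ht1 (toCompletion N hN g.out)
      (toCompletion N hN h.out)
    rw [hout, hout] at h1
    have h2 : (quotientDist S (N n) g h : ℝ) / 2 ≤ t * a n / 2 := by
      have h3 : (quotientDist S (N n) g h : ℝ) ≤ quotientDiam S (N n) := by
        exact_mod_cast quotientDist_le_quotientDiam (N n) g h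
      have h4 : (quotientDiam S (N n) : ℝ) ≤ (a (n + 1))⁻¹ * a n := by
        rw [le_inv_mul_iff₀ hpos]
        exact (hconv n).le
      have h5 := mul_le_mul_of_nonneg_right ht2 (ha n).le
      linarith
    have h3 : (0 : ℝ) ≤ quotientDist S (N n) g h := Nat.cast_nonneg _
    have h4 := (le_min (by linarith) h2).trans h1
    change (quotientDist S (N n) g h : ℝ) ≤ 2 * levelDist S (completionDist a) t _ _
    linarith
  · have h1 := levelDist_le_quotientDist_add hS ha hconv hn ht1 (toCompletion N hN g.out)
      (toCompletion N hN h.out)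
    rw [hout, hout] at h1
    refine h1.trans (add_le_add le_rfl ?_)
    have h2 : a (n + 1) ≤ 2 := le_two_of_ne_top ha ha0 hdiam (ne_top_of_le hN (Nat.le_succ n) hn)
    rcases max_choice 1 (a (n + 1))⁻¹ with h | h
    · rw [ht, h, one_mul]
      exact h2
    · rw [ht, h, inv_mul_cancel₀ hpos.ne']
      norm_num

/-- Maps on the quotients that have a common lower control function and that are uniformly
bounded on neighbours form a uniform embedding. -/
theorem uniformEmbedding_of_neighbours (hS : Subgroup.closure (S : Set Γ) = ⊤) {H : Type u}
    [NormedAddCommGroup H] [InnerProductSpace ℝ H] [CompleteSpace H] (f : ∀ n, Γ ⧸ N n → H)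
    {K : ℝ} (hK : ∀ n, ∀ s ∈ S, ∀ g : Γ ⧸ N n, ‖f n g - f n (s * g)‖ ≤ K) {φ : ℝ → ℝ}
    (hφ : Controlled aff φ)
    (h : ∀ n g h, (quotientDist S (N n) g h : ℝ) ≤ φ ‖f n g - f n h‖) :
    UniformEmbedding aff S N := by
  refine ⟨H, inferInstance, inferInstance, inferInstance, f, max K 0, ⟨le_max_right _ _,
    fun n g h => ?_⟩, φ, hφ, h⟩
  refine le_mul_quotientDist hS (N n) (P := fun g h => ‖f n g - f n h‖) ⟨fun g => by simp,
    fun g h => norm_sub_rev _ _, fun g h k => norm_sub_le_norm_sub_add_norm_sub _ _ _⟩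
    (fun s hs g => (hK n s hs g).trans (le_max_left _ _)) g h

theorem ControlledEmbedding.uniformEmbedding_of_cone [∀ n, (N n).FiniteIndex]
    (hS : Subgroup.closure (S : Set Γ) = ⊤) {hN : Antitone N}
    {a : ℕ → ℝ} (ha : ∀ n, 0 < a n) (ha0 : Tendsto a atTop (𝓝 0))
    (hdiam : ∀ g h : completion N hN, completionDist a g h ≤ 2)
    (hconv : ∀ n, a (n + 1) * (quotientDiam S (N n) : ℝ) < a n)
    (h : ControlledEmbedding aff (warpedConeDist S (completionDist (N := N) (hN := hN) a))) :
    UniformEmbedding aff S N := by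
  obtain ⟨H, i1, i2, i3, f, hf, φ, hφ, hlow⟩ := h
  choose ι hι using exists_level_section hS ha ha0 hdiam hconv
  -- Neighbours are at distance at most 1, and the section adds at most 2.
  obtain ⟨K, hK⟩ := hf 3
  refine uniformEmbedding_of_neighbours hS (fun n g => f (ι n g)) (K := K) (fun n s hs g => ?_)
    (φ := fun r => 2 * φ (1 * r) + 0 * max r 0 + 0)
    (hφ.comp zero_le_two zero_le_one le_rfl le_rfl) fun n g h => ?_
  · refine hK _ _ ((hι n _ _).2.trans ?_)
    have : (quotientDist S (N n) g (s * g) : ℝ) ≤ 1 := by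
      exact_mod_cast quotientDist_smul_le (N n) hs g
    linarith
  · have h1 := (hι n g h).1
    have h2 := hlow (ι n g) (ι n h)
    simp only [one_mul, zero_mul, add_zero]
    linarith

/-! ### Coarse disjoint sums -/

theorem ControlledEmbedding.uniformEmbedding_of_sum (hS : Subgroup.closure (S : Set Γ) = ⊤)
    {D : (Σ n, Γ ⧸ N n) → (Σ n, Γ ⧸ N n) → ℝ} (hD : IsCoarseDisjointSum S N D)
    (h : ControlledEmbedding aff D) : UniformEmbedding aff S N := by
  obtain ⟨H, i1, i2, i3, f, hf, φ, hφ, hlow⟩ := h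
  obtain ⟨K, hK⟩ := hf 1
  refine uniformEmbedding_of_neighbours hS (fun n g => f ⟨n, g⟩) (K := K)
    (fun n s hs g => hK _ _ ?_) hφ fun n g h => ?_
  · rw [hD.restrict]
    exact_mod_cast quotientDist_smul_le (N n) hs g
  · rw [← hD.restrict]
    exact hlow _ _

/-- The map on the disjoint sum that is `f n`, based at the identity, on the `n`-th piece, which
is moved by `c n` in a new direction. -/
def sumMap {H : Type u} [NormedAddCommGroup H] (f : ∀ n, Γ ⧸ N n → H) (c : ℕ → ℝ)
    (x : Σ n, Γ ⧸ N n) : lp (fun _ : ℕ => WithLp 2 (H × ℝ)) 2 :=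
  lp.single 2 x.1 (WithLp.toLp 2 (f x.1 x.2 - f x.1 1, c x.1))

section SumMap

variable {H : Type u} [NormedAddCommGroup H] (f : ∀ n, Γ ⧸ N n → H) {c : ℕ → ℝ}

theorem norm_sumMap_sub_same (n : ℕ) (g h : Γ ⧸ N n) :
    ‖sumMap f c ⟨n, g⟩ - sumMap f c ⟨n, h⟩‖ = ‖f n g - f n h‖ := by
  simp only [sumMap]
  rw [← lp.single_sub, lp.norm_single (by norm_num), ← WithLp.toLp_sub, Prod.mk_sub_mk,
    sub_sub_sub_cancel_right, sub_self, WithLp.norm_toLp_fst]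

theorem norm_sumMap_le (hc : ∀ n, 0 ≤ c n) (n : ℕ) (g : Γ ⧸ N n) :
    ‖sumMap f c ⟨n, g⟩‖ ≤ ‖f n g - f n 1‖ + c n := by
  rw [sumMap, lp.norm_single (by norm_num)]
  refine (norm_toLp_prod_le _ _).trans_eq ?_
  rw [Real.norm_of_nonneg (hc n)]

theorem le_norm_sumMap_sub {n m : ℕ} (hnm : n ≠ m) (g : Γ ⧸ N n) (h : Γ ⧸ N m) :
    c n ≤ ‖sumMap f c ⟨n, g⟩ - sumMap f c ⟨m, h⟩‖ := by
  have h1 := lp.norm_apply_le_norm (E := fun _ : ℕ => WithLp 2 (H × ℝ)) (p := 2) (by norm_num)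
    (sumMap f c ⟨n, g⟩ - sumMap f c ⟨m, h⟩) n
  simp only [lp.coeFn_sub, Pi.sub_apply, sumMap] at h1
  rw [lp.single_apply_self, lp.single_apply_ne _ _ _ hnm, sub_zero] at h1
  exact (le_abs_self _).trans ((WithLp.norm_snd_le _ _).trans h1)

end SumMap

/-- For points in different pieces, a bound on either distance bounds both indices, leaving finitely
many points on which any function is bounded. -/
theorem UniformEmbedding.embedsCoarsely_sum [∀ n, (N n).FiniteIndex]
    (h : UniformEmbedding aff S N)
    {D : (Σ n, Γ ⧸ N n) → (Σ n, Γ ⧸ N n) → ℝ} (hD : IsCoarseDisjointSum S N D) :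
    EmbedsCoarsely D := by
  obtain ⟨H, i1, i2, i3, f, L, ⟨hL, hf⟩, φ, hφ, hlow⟩ := h
  have hc : ∀ n : ℕ, (0 : ℝ) ≤ n := fun n => Nat.cast_nonneg n
  have hfin : ∀ k : ℕ, {x : Σ n, Γ ⧸ N n | x.1 < k}.Finite := fun k =>
    ((Set.finite_Iio k).biUnion fun n _ =>
      Set.finite_range (Sigma.mk (β := fun n => Γ ⧸ N n) n)).subset
      fun x hx => Set.mem_biUnion (x := x.1) hx ⟨x.2, rfl⟩
  have hbdd : ∀ (k : ℕ) (P : (Σ n, Γ ⧸ N n) → (Σ n, Γ ⧸ N n) → ℝ),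
      ∃ K, ∀ x y, x.1 < k → y.1 < k → P x y ≤ K := fun k P => by
    obtain ⟨K, hK⟩ := (((hfin k).prod (hfin k)).image fun p => P p.1 p.2).bddAbove
    exact ⟨K, fun x y hx hy => hK ⟨(x, y), ⟨hx, hy⟩, rfl⟩⟩
  have hlow' : ∀ K, ∃ R, ∀ p : (Σ n, Γ ⧸ N n) × (Σ n, Γ ⧸ N n),
      ‖sumMap f (fun n => n) p.1 - sumMap f (fun n => n) p.2‖ ≤ K → D p.1 p.2 ≤ R := fun K => by
    obtain ⟨R, hR⟩ := hbdd (⌊K⌋₊ + 1) D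
    refine ⟨max R (φ K), ?_⟩
    rintro ⟨⟨n, g⟩, ⟨m, h⟩⟩ hK
    by_cases hnm : n = m
    · subst hnm
      refine le_max_of_le_right ?_
      dsimp only at hK
      rw [norm_sumMap_sub_same] at hK
      dsimp only
      rw [hD.restrict]
      exact (hlow n g h).trans (hφ.mono hK)
    · refine le_max_of_le_left (hR _ _ (Nat.lt_succ_of_le (Nat.le_floor ?_))
        (Nat.lt_succ_of_le (Nat.le_floor ?_)))
      · exact (le_norm_sumMap_sub f hnm g h).trans hK
      · dsimp only at hK
        rw [norm_sub_rev] at hK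
        exact (le_norm_sumMap_sub f (Ne.symm hnm) h g).trans hK
  obtain ⟨ψ, hψ, hψ'⟩ := exists_controlled_of_forall hlow'
  refine ControlledEmbedding.embedsCoarsely (aff := False)
    ⟨lp (fun _ : ℕ => WithLp 2 (H × ℝ)) 2, inferInstance, inferInstance, inferInstance,
    sumMap f fun n => n, fun R => ?_, ψ, hψ, fun x y => hψ' (x, y)⟩
  obtain ⟨k, hk⟩ := hD.separated (R + 1)
  obtain ⟨K, hK⟩ := hbdd k fun x y => ‖sumMap f (fun n => n) x - sumMap f (fun n => n) y‖
  refine ⟨max K (L * R), ?_⟩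
  rintro ⟨n, g⟩ ⟨m, h⟩ hR
  by_cases hnm : n = m
  · subst hnm
    refine le_max_of_le_right ?_
    rw [hD.restrict] at hR
    rw [norm_sumMap_sub_same]
    exact (hf n g h).trans (mul_le_mul_of_nonneg_left hR hL)
  · have hlt : max n m < k := by
      by_contra! hle
      linarith [hk n m hnm hle g h]
    exact le_max_of_le_left (hK _ _ (lt_of_le_of_lt (le_max_left n m) hlt)
      (lt_of_le_of_lt (le_max_right n m) hlt))

theorem UniformEmbedding.embedsQuasiIsometrically_sum
    (h : UniformEmbedding True S N)
    {D : (Σ n, Γ ⧸ N n) → (Σ n, Γ ⧸ N n) → ℝ} (hD : IsCoarseDisjointSum S N D)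
    (hrad : IsRadial N D) : EmbedsQuasiIsometrically D := by
  obtain ⟨H, i1, i2, i3, f, L, ⟨hL, hf⟩, φ, hφ, hlow⟩ := h
  obtain ⟨w, A, B, hw, hA, hAB⟩ := hrad
  -- A detour through another piece bounds the size of a piece in terms of `w`, even if `w` was not
  -- chosen to dominate diameters.
  have hquot : ∀ {n m : ℕ}, n ≠ m → ∀ g : Γ ⧸ N n,
      (quotientDist S (N n) g 1 : ℝ) ≤ 2 * (A * (w n + w m) + B) := fun {n m} hnm g => by
    have h1 := (hAB n m hnm g 1).2
    have h2 := (hAB n m hnm 1 1).2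
    have h3 := hD.pseudo.triangle ⟨n, g⟩ ⟨m, 1⟩ ⟨n, 1⟩
    rw [hD.restrict, hD.pseudo.symm ⟨m, 1⟩] at h3
    linarith
  have hup : ∀ x y, ‖sumMap f w x - sumMap f w y‖ ≤
      (L + (4 * L * A + 1) * A) * D x y + (4 * L * |B| + (4 * L * A + 1) * A * |B|) := by
    rintro ⟨n, g⟩ ⟨m, h⟩
    have hD0 := hD.pseudo.nonneg ⟨n, g⟩ ⟨m, h⟩
    by_cases hnm : n = m
    · subst hnm
      rw [norm_sumMap_sub_same]
      have h1 := hf n g h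
      rw [← hD.restrict] at h1
      have : 0 ≤ (4 * L * A + 1) * A * D ⟨n, g⟩ ⟨n, h⟩ := by positivity
      have : 0 ≤ 4 * L * |B| + (4 * L * A + 1) * A * |B| := by positivity
      linarith
    · have h1 := norm_sub_le (sumMap f w ⟨n, g⟩) (sumMap f w ⟨m, h⟩)
      have h2 := norm_sumMap_le f hw n g
      have h3 := norm_sumMap_le f hw m h
      have h4 := mul_le_mul_of_nonneg_left (hquot hnm g) hL
      have h5 := mul_le_mul_of_nonneg_left (hquot (Ne.symm hnm) h) hL
      have h6 := hf n g 1
      have h7 := hf m h 1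
      have h8 : w n + w m ≤ A * (D ⟨n, g⟩ ⟨m, h⟩ + |B|) := by
        rw [← div_le_iff₀' hA]
        linarith [(hAB n m hnm g h).1, le_abs_self B]
      have h9 := mul_le_mul_of_nonneg_left h8 (by positivity : 0 ≤ 4 * L * A + 1)
      have h10 := mul_le_mul_of_nonneg_left (le_abs_self B) hL
      have h11 := mul_nonneg hL hD0
      linarith
  refine embedsQuasiIsometrically_of_controlled hD.pseudo.nonneg hup
    (φ := fun r => 1 * φ (1 * r) + 2 * A * max r 0 + |B|)
    (hφ.comp zero_le_one zero_le_one (by positivity) (abs_nonneg B)) ?_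
  rintro ⟨n, g⟩ ⟨m, h⟩
  simp only [one_mul]
  by_cases hnm : n = m
  · subst hnm
    rw [norm_sumMap_sub_same, hD.restrict]
    have : 0 ≤ 2 * A * max ‖f n g - f n h‖ 0 + |B| := by positivity
    linarith [hlow n g h]
  · have h1 := le_norm_sumMap_sub f (c := w) hnm g h
    have h2 := le_norm_sumMap_sub f (c := w) (Ne.symm hnm) h g
    rw [norm_sub_rev] at h2
    have h3 := mul_le_mul_of_nonneg_left (add_le_add h1 h2) hA.le
    rw [max_eq_left (norm_nonneg _)]
    have h4 := hφ.nonneg ‖sumMap f w ⟨n, g⟩ - sumMap f w ⟨m, h⟩‖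
    linarith [(hAB n m hnm g h).2, le_abs_self B]

end Main

/-! ### The Haagerup property -/

section Displacement

variable {G H : Type*} [Group G] [Fintype G] [NormedAddCommGroup H] (f : G → H)

/-- The mean squared displacement of `f` under left translation by `g`. -/
def meanDisplacement (g : G) : ℝ := (∑ x, ‖f (g * x) - f x‖ ^ 2) / Fintype.card G

theorem meanDisplacement_one : meanDisplacement f 1 = 0 := by
  simp [meanDisplacement]

/-- Substituting `h⁻¹ * x` for `x` turns the displacement into a mean squared distance between
vectors indexed by `g` and `h`. -/
theorem meanDisplacement_inv_mul (g h : G) :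
    meanDisplacement f (g⁻¹ * h) = (∑ x, ‖f (g⁻¹ * x) - f (h⁻¹ * x)‖ ^ 2) / Fintype.card G := by
  rw [meanDisplacement, ← Equiv.sum_comp (Equiv.mulLeft h⁻¹)]
  simp [mul_assoc]

theorem meanDisplacement_inv (g : G) : meanDisplacement f g⁻¹ = meanDisplacement f g := by
  have h1 := meanDisplacement_inv_mul f g 1
  have h2 := meanDisplacement_inv_mul f 1 g
  rw [mul_one] at h1
  rw [inv_one, one_mul] at h2
  rw [h1, h2]
  simp [norm_sub_rev]

theorem meanDisplacement_nonneg (g : G) : 0 ≤ meanDisplacement f g :=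
  div_nonneg (Finset.sum_nonneg fun _ _ => by positivity) (Nat.cast_nonneg _)

theorem meanDisplacement_le {g : G} {c : ℝ} (h : ∀ x, ‖f (g * x) - f x‖ ^ 2 ≤ c) :
    meanDisplacement f g ≤ c := by
  have hcard : (0 : ℝ) < Fintype.card G := by exact_mod_cast Fintype.card_pos
  rw [meanDisplacement, div_le_iff₀ hcard]
  refine (Finset.sum_le_card_nsmul _ _ c fun x _ => h x).trans_eq ?_
  rw [nsmul_eq_mul, mul_comm, Finset.card_univ]

theorem exists_sq_norm_le_meanDisplacement (g : G) :
    ∃ x, ‖f (g * x) - f x‖ ^ 2 ≤ meanDisplacement f g := by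
  have hcard : (0 : ℝ) < Fintype.card G := by exact_mod_cast Fintype.card_pos
  obtain ⟨x, -, hx⟩ := Finset.exists_le_of_sum_le (s := Finset.univ)
    (f := fun x => ‖f (g * x) - f x‖ ^ 2) (g := fun _ => meanDisplacement f g)
    Finset.univ_nonempty (by
      rw [Finset.sum_const, Finset.card_univ, nsmul_eq_mul, meanDisplacement,
        mul_div_cancel₀ _ hcard.ne'])
  exact ⟨x, hx⟩

/-- For coefficients of sum zero, `∑ c γ c γ' ‖v γ - v γ'‖²` equals `-2 ‖∑ c γ v γ‖²`; average this
over `x`. -/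
theorem sum_meanDisplacement_nonpos [InnerProductSpace ℝ H] {Γ : Type*} [Group Γ] (π : Γ →* G)
    (F : Finset Γ) (c : Γ → ℝ) (hc : ∑ γ ∈ F, c γ = 0) :
    ∑ γ ∈ F, ∑ γ' ∈ F, c γ * c γ' * meanDisplacement f (π (γ⁻¹ * γ')) ≤ 0 := by
  have key : ∀ v : Γ → H, ∑ γ ∈ F, ∑ γ' ∈ F, c γ * c γ' * ‖v γ - v γ'‖ ^ 2 ≤ 0 := fun v => by
    have h := inner_sum_smul_sum_smul_of_sum_eq_zero v hc v hc
    rw [real_inner_self_eq_norm_sq] at h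
    simp only [← pow_two] at h
    have := sq_nonneg ‖∑ γ ∈ F, c γ • v γ‖
    linarith
  have e : ∑ γ ∈ F, ∑ γ' ∈ F, c γ * c γ' * meanDisplacement f (π (γ⁻¹ * γ')) =
      (∑ x : G, ∑ γ ∈ F, ∑ γ' ∈ F, c γ * c γ' *
        ‖f ((π γ)⁻¹ * x) - f ((π γ')⁻¹ * x)‖ ^ 2) / Fintype.card G := by
    rw [Finset.sum_comm (s := (Finset.univ : Finset G)), Finset.sum_div]
    refine Finset.sum_congr rfl fun γ _ => ?_
    rw [Finset.sum_comm (s := (Finset.univ : Finset G)), Finset.sum_div]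
    refine Finset.sum_congr rfl fun γ' _ => ?_
    rw [map_mul, map_inv, meanDisplacement_inv_mul, ← Finset.mul_sum, mul_div_assoc]
  rw [e]
  exact div_nonpos_of_nonpos_of_nonneg
    (Finset.sum_nonpos fun x _ => key fun γ => f ((π γ)⁻¹ * x)) (Nat.cast_nonneg _)

end Displacement

/-- By right invariance, left translation by γ moves every point of G_n by the length of γ in G_n.
Small mean displacement thus forces γ to be short in G_n. -/
theorem UniformEmbedding.haagerupProperty {Γ : Type u} [Group Γ] {S : Finset Γ}
    {N : ℕ → Subgroup Γ} [∀ n, (N n).Normal] [∀ n, (N n).FiniteIndex] {aff : Prop}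
    (h : UniformEmbedding aff S N) (hS : Subgroup.closure (S : Set Γ) = ⊤) (hN : Antitone N)
    (htriv : ⨅ n, N n = ⊥) : HaagerupProperty Γ := by
  obtain ⟨H, i1, i2, i3, f, L, ⟨hL, hf⟩, φ, hφ, hlow⟩ := h
  have : ∀ n, Fintype (Γ ⧸ N n) := fun n => Fintype.ofFinite _
  let p : ℕ → Γ → ℝ := fun n γ => meanDisplacement (f n) (γ : Γ ⧸ N n)
  have hdist : ∀ n (γ : Γ) (x : Γ ⧸ N n), quotientDist S (N n) x (γ * x) =
      wordLength ((fun s : Γ => (s : Γ ⧸ N n)) '' (S : Set Γ)) (γ : Γ ⧸ N n) := fun n γ x => by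
    rw [quotientDist, mul_inv_cancel_right]
  have hp : ∀ n γ, p n γ ∈ Set.Icc 0 ((L * wordLength (S : Set Γ) γ) ^ 2) := fun n γ =>
    ⟨meanDisplacement_nonneg _ _, meanDisplacement_le _ fun x => by
      have h1 := hf n x (γ * x)
      have h2 : (quotientDist S (N n) x (γ * x) : ℝ) ≤ wordLength (S : Set Γ) γ := by
        rw [hdist]
        exact_mod_cast wordLength_mk_le hS (N n) γ
      rw [norm_sub_rev]
      exact pow_le_pow_left₀ (norm_nonneg _) (h1.trans (mul_le_mul_of_nonneg_left h2 hL)) 2⟩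
  -- For fixed γ the displacements lie in a compact interval, so the ultralimit exists.
  have hlim : ∀ γ, ∃ l, Tendsto (fun n => p n γ) (hyperfilter ℕ : Filter ℕ) (𝓝 l) := fun γ => by
    obtain ⟨l, -, hl⟩ := isCompact_Icc.ultrafilter_le_nhds
      ((hyperfilter ℕ).map fun n => p n γ) (by
        rw [le_principal_iff]
        exact Ultrafilter.mem_map.2 (univ_mem' fun n => hp n γ))
    exact ⟨l, hl⟩
  choose ψ hψ using hlim
  refine ⟨ψ, ?_, fun γ => ?_, fun F c hc => ?_, fun R => ?_⟩
  · refine tendsto_nhds_unique (hψ 1) (tendsto_const_nhds.congr fun n => ?_)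
    exact (meanDisplacement_one (f n)).symm
  · exact tendsto_nhds_unique (hψ γ⁻¹) ((hψ γ).congr fun n =>
      (meanDisplacement_inv (f n) (γ : Γ ⧸ N n)).symm)
  · refine le_of_tendsto (tendsto_finsetSum _ fun γ _ => tendsto_finsetSum _ fun γ' _ =>
      (hψ (γ⁻¹ * γ')).const_mul (c γ * c γ')) (Eventually.of_forall fun n => ?_)
    exact sum_meanDisplacement_nonpos (f n) (QuotientGroup.mk' (N n)) F c hc
  · set k := ⌊φ (√(R + 1))⌋₊
    refine (finite_wordLength_le hS S.finite_toSet k).subset fun γ hγ => ?_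
    have hγ' : ψ γ < R + 1 := lt_of_le_of_lt hγ (lt_add_one R)
    -- modulo every `N n`, `γ` agrees with an element of length at most `k`
    have hball : ∀ n, ∃ b, wordLength (S : Set Γ) b ≤ k ∧ b⁻¹ * γ ∈ N n := fun n => by
      -- Sets in a nonprincipal ultrafilter are infinite, so `m` can be taken beyond `n`, where `N m
      -- ≤ N n`.
      have hfreq : ∃ᶠ m in atTop, p m γ < R + 1 := by
        rw [← Nat.cofinite_eq_atTop]
        exact ((hψ γ).eventually_lt_const hγ').frequently.filter_mono hyperfilter_le_cofinite
      obtain ⟨m, hnm, hm⟩ := hfreq.forall_exists_of_atTop n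
      obtain ⟨x, hx⟩ := exists_sq_norm_le_meanDisplacement (f m) (γ : Γ ⧸ N m)
      have h1 : ‖f m x - f m (γ * x)‖ ≤ √(R + 1) := by
        rw [norm_sub_rev]
        exact Real.le_sqrt_of_sq_le (hx.trans hm.le)
      have h2 := (hlow m x (γ * x)).trans (hφ.mono h1)
      rw [hdist] at h2
      obtain ⟨b, hb1, hb2⟩ := exists_lift_wordLength_le hS (N m) (γ : Γ ⧸ N m)
      exact ⟨b, hb2.trans (Nat.le_floor h2), hN hnm (QuotientGroup.eq.1 hb1)⟩
    -- Otherwise triviality of the intersection separates γ from each element of the ball. As the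
    -- ball is finite, a single `N M` does so for all of them, against `hball`.
    by_contra hγk
    have hne : ∀ b : Γ, ∃ n, wordLength (S : Set Γ) b ≤ k → b⁻¹ * γ ∉ N n := fun b => by
      by_contra! hall
      have : b⁻¹ * γ ∈ ⨅ n, N n := Subgroup.mem_iInf.2 fun n => (hall n).2
      rw [htriv, Subgroup.mem_bot, inv_mul_eq_one] at this
      exact hγk (this ▸ (hall 0).1)
    choose n hn using hne
    obtain ⟨M, hM⟩ := ((finite_wordLength_le hS S.finite_toSet k).image n).bddAbove
    obtain ⟨b, hb1, hb2⟩ := hball M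
    exact hn b hb1 (hN (hM ⟨b, hb1, rfl⟩) hb2)

end WarpedBox

end

/-! ### The main theorem -/

open WarpedBox in
theorem theoremT {Γ : Type u} [Group Γ] (S : Finset Γ) (hS : Subgroup.closure (S : Set Γ) = ⊤)
    (N : ℕ → Subgroup Γ) [∀ n, (N n).Normal] [∀ n, (N n).FiniteIndex] (hN : Antitone N)
    (a : ℕ → ℝ) (ha : ∀ n, 0 < a n) (ha0 : Tendsto a atTop (𝓝 0))
    (hdiam : ∀ g h : completion N hN, completionDist a g h ≤ 2)
    (hconv : ∀ n, a (n + 1) * (quotientDiam S (N n) : ℝ) < a n) :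
    -- the coarse equivalence, for every metric on the coarse disjoint sum
    (∀ D, IsCoarseDisjointSum S N D →
      (EmbedsCoarsely D ↔
        EmbedsCoarsely (warpedConeDist S (completionDist (N := N) (hN := hN) a)))) ∧
    -- the quasi-isometric equivalence
    (∀ D, IsCoarseDisjointSum S N D → EmbedsQuasiIsometrically D →
      EmbedsQuasiIsometrically (warpedConeDist S (completionDist (N := N) (hN := hN) a))) ∧
    (∀ D, IsCoarseDisjointSum S N D → IsRadial N D →
      EmbedsQuasiIsometrically (warpedConeDist S (completionDist (N := N) (hN := hN) a)) →
      EmbedsQuasiIsometrically D) ∧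
    -- the Haagerup property
    ((⨅ n, N n) = ⊥ →
      ((∃ D, IsCoarseDisjointSum S N D ∧ (EmbedsCoarsely D ∨ EmbedsQuasiIsometrically D)) ∨
        EmbedsCoarsely (warpedConeDist S (completionDist (N := N) (hN := hN) a)) ∨
        EmbedsQuasiIsometrically (warpedConeDist S (completionDist (N := N) (hN := hN) a))) →
      HaagerupProperty Γ) := by
  have hW := (isWarping_warpedConeDist (S := S)
    (completionDist_nonneg (N := N) (hN := hN) ha)).pseudo.nonneg
  refine ⟨fun D hD => ⟨fun h => ?_, fun h => ?_⟩, fun D hD h => ?_, fun D hD hrad h => ?_,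
    fun htriv h => ?_⟩
  · exact (((h.controlledEmbedding hD.pseudo.nonneg).uniformEmbedding_of_sum hS
      hD).lipschitzEmbedding_warpedConeDist hS ha ha0 hdiam hconv).embedsCoarsely hW
  · exact ((h.controlledEmbedding hW).uniformEmbedding_of_cone hS ha ha0 hdiam
      hconv).embedsCoarsely_sum hD
  · exact ((h.controlledEmbedding.uniformEmbedding_of_sum hS
      hD).lipschitzEmbedding_warpedConeDist hS ha ha0 hdiam hconv).embedsQuasiIsometrically hW
  · exact (h.controlledEmbedding.uniformEmbedding_of_cone hS ha ha0 hdiam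
      hconv).embedsQuasiIsometrically_sum hD hrad
  · rcases h with ⟨D, hD, h | h⟩ | h | h
    · exact ((h.controlledEmbedding hD.pseudo.nonneg).uniformEmbedding_of_sum hS
        hD).haagerupProperty hS hN htriv
    · exact (h.controlledEmbedding.uniformEmbedding_of_sum hS hD).haagerupProperty hS hN htriv
    · exact ((h.controlledEmbedding hW).uniformEmbedding_of_cone hS ha ha0 hdiam
        hconv).haagerupProperty hS hN htriv
    · exact (h.controlledEmbedding.uniformEmbedding_of_cone hS ha ha0 hdiam
        hconv).haagerupProperty hS hN htriv
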